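/- Let $d\ge 1$, $T>0$, $\nu>0$, and let $f\in C^1(\mathbb R;\mathbb R^d)$. Consider $$u_t+\nabla\cdot f(u)=\nu\Delta u\quad\text{on }\Omega\times(0,T)$$ in one of two settings. (D) Homogeneous Dirichlet conditions: $\Omega\subset\mathbb R^d$ is a nonempty bounded open set (for instance a bounded Lipschitz domain), and $V:=H^1_0(\Omega)$. (P) Periodic conditions with zero mean: $\Omega=\{\sum_i s_i b_i:0\le s_i<1\}$ is the period cell of the lattice spanned by a basis $b_1,\dots,b_d$ of $\mathbb R^d$ (for instance a box), and $V:=\{v\in H^1_{\rm per}(\Omega):\int_\Omega v\,dx=0\}$, where $H^1_{\rm per}(\Omega)$ is the $H^1(\Omega)$-closure of the smooth periodic functions. Write $H^{-1}:=V^*$. For $u\in L^2(0,T;V)$ the residual $\mathcal R(u):=u_t+\nabla\cdot f(u)-\nu\Delta u$ is understood in the sense of distributions on $(0,T)\times\Omega$ (periodic distributions in setting (P)), and $u$ is a weak solution of the equation if $\mathcal R(u)=0$. The Poincaré constant $C_P$ of $V$, that is, the least constant with $\|v\|_{L^2(\Omega)}\le C_P\|\nabla v\|_{L^2(\Omega)}$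 for all $v\in V$, exists, is positive, and depends only on $\Omega$ and the boundary condition. It has the following property. Let $u^\nu\in L^2(0,T;V)$ be a weak solution of the equation, and let $u\in L^2(0,T;V)$ satisfy $u_t\in L^2(0,T;H^{-1})$ and $\mathcal R(u)\in L^2(0,T;L^2(\Omega))$. Let $I$ be the union of the essential ranges of $u$ and $u^\nu$ on $(0,T)\times\Omega$, and suppose that $$L_f:=\sup_{s\in I}\|f'(s)\|_{\mathbb R^d}<\infty .$$ Then $u$ and $u^\nu$ have representatives in $C([0,T];L^2(\Omega))$, and with these representatives the error $e:=u^\nu-u$ satisfies, for all $t\in[0,T]$, $$\|e(t)\|_{L^2(\Omega)}\le\exp\!\left(\frac{L_f^2}{2\nu}t\right)\left[\|e(0)\|_{L^2(\Omega)}+\frac{C_P}{\sqrt\nu}\,\|\mathcal R(u)\|_{L^2(0,t;L^2(\Omega))}\right].$$ -/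

import Mathlib

open MeasureTheory Set Filter Topology
open scoped ContDiff

noncomputable section

namespace ViscousLaw

/-- The space `ℝ^d` with its Euclidean norm. -/
abbrev Space (d : ℕ) : Type := EuclideanSpace ℝ (Fin d)

/-- The two kinds of boundary conditions: homogeneous Dirichlet conditions on a bounded, nonempty
open set `Ω` (no regularity of the boundary is asked for), or periodicity with respect to the
lattice spanned by a basis `b` of `ℝ^d`, together with zero spatial mean. A box with side lengths
`ℓ i` is the case `b i = ℓ i • e i`. -/
inductive BoundaryCondition (d : ℕ) : Type
  | dirichlet (Ω : Set (Space d)) (isOpen : IsOpen Ω) (isBounded : Bornology.IsBounded Ω)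
      (nonempty : Ω.Nonempty) : BoundaryCondition d
  | periodic (b : Module.Basis (Fin d) ℝ (Space d)) : BoundaryCondition d

/-- Pairs of an `L²` function and an `L²` vector field, with the norm
`(‖v‖² + ‖G‖²)^(1/2)`. A function `v` in `H¹` is represented by the pair `(v, ∇v)`. -/
abbrev L2Pair {d : ℕ} (μ : Measure (Space d)) : Type :=
  WithLp 2 (Lp ℝ 2 μ × Lp (Space d) 2 μ)

namespace BoundaryCondition

variable {d : ℕ}

/-- The spatial domain: `Ω`, or the period cell `{∑ i, s i • b i : 0 ≤ s i < 1}`. -/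
def domain : BoundaryCondition d → Set (Space d)
  | dirichlet Ω _ _ _ => Ω
  | periodic b => ZSpan.fundamentalDomain b

/-- Lebesgue measure on the spatial domain. -/
def measure (B : BoundaryCondition d) : Measure (Space d) := volume.restrict B.domain

/-- Spatial test functions: `C_c^∞(Ω)`, respectively smooth periodic functions (of any mean). -/
def IsTest : BoundaryCondition d → (Space d → ℝ) → Prop
  | dirichlet Ω _ _ _, φ => ContDiff ℝ ∞ φ ∧ HasCompactSupport φ ∧ tsupport φ ⊆ Ω
  | periodic b, φ => ContDiff ℝ ∞ φ ∧ ∀ i x, φ (x + b i) = φ x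

theorem isBounded_domain (B : BoundaryCondition d) : Bornology.IsBounded B.domain := by
  cases B with
  | dirichlet Ω _ h _ => exact h
  | periodic b => exact ZSpan.fundamentalDomain_isBounded b

instance (B : BoundaryCondition d) : IsFiniteMeasure B.measure :=
  ⟨by simpa [measure] using B.isBounded_domain.measure_lt_top⟩

theorem IsTest.contDiff {B : BoundaryCondition d} {φ : Space d → ℝ} (h : B.IsTest φ) :
    ContDiff ℝ ∞ φ := by
  cases B <;> exact h.1

theorem IsTest.zero (B : BoundaryCondition d) : B.IsTest 0 := by
  cases B with
  | dirichlet Ω _ _ _ =>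
    exact ⟨contDiff_const, HasCompactSupport.zero, by simp [tsupport]⟩
  | periodic b => exact ⟨contDiff_const, fun _ _ => rfl⟩

theorem IsTest.add {B : BoundaryCondition d} {φ ψ : Space d → ℝ} (h : B.IsTest φ)
    (k : B.IsTest ψ) : B.IsTest (φ + ψ) := by
  cases B with
  | dirichlet Ω _ _ _ =>
    exact ⟨h.1.add k.1, h.2.1.add k.2.1,
      (tsupport_add φ ψ).trans (union_subset h.2.2 k.2.2)⟩
  | periodic b => exact ⟨h.1.add k.1, fun i x => by simp [h.2 i x, k.2 i x]⟩

theorem IsTest.smul {B : BoundaryCondition d} {φ : Space d → ℝ} (c : ℝ) (h : B.IsTest φ) :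
    B.IsTest (c • φ) := by
  cases B with
  | dirichlet Ω _ _ _ =>
    exact ⟨h.1.const_smul c, h.2.1.smul_left (f := fun _ => c),
      (tsupport_smul_subset_right (fun _ => c) φ).trans h.2.2⟩
  | periodic b => exact ⟨h.1.const_smul c, fun i x => by simp [h.2 i x]⟩

/-- The pairs `(φ, ∇φ)` for spatial test functions `φ`. -/
def smoothPairs (B : BoundaryCondition d) : Submodule ℝ (L2Pair B.measure) where
  carrier := {p | ∃ φ, B.IsTest φ ∧ p.fst =ᵐ[B.measure] φ ∧ p.snd =ᵐ[B.measure] gradient φ}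
  zero_mem' := by
    refine ⟨0, IsTest.zero B, Lp.coeFn_zero _ _ _, ?_⟩
    have : gradient (0 : Space d → ℝ) = 0 := by
      funext x; exact gradient_const x (0 : ℝ)
    rw [this]
    exact Lp.coeFn_zero _ _ _
  add_mem' := by
    rintro p q ⟨φ, h, h1, h2⟩ ⟨ψ, k, k1, k2⟩
    refine ⟨φ + ψ, h.add k, (Lp.coeFn_add p.fst q.fst).trans (h1.add k1), ?_⟩
    have : gradient (φ + ψ) = gradient φ + gradient ψ := by
      funext x
      have e := fderiv_add (h.contDiff.differentiable (by simp) x)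
        (k.contDiff.differentiable (by simp) x)
      simp only [gradient, Pi.add_apply, e, map_add]
    rw [this]
    exact (Lp.coeFn_add p.snd q.snd).trans (h2.add k2)
  smul_mem' := by
    rintro c p ⟨φ, h, h1, h2⟩
    refine ⟨c • φ, h.smul c, (Lp.coeFn_smul c p.fst).trans (h1.const_smul c), ?_⟩
    have : gradient (c • φ) = c • gradient φ := by
      funext x
      have e := fderiv_const_smul (h.contDiff.differentiable (by simp) x) c
      simp only [gradient, Pi.smul_apply, e, map_smul]
    rw [this]
    exact (Lp.coeFn_smul c p.snd).trans (h2.const_smul c)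

/-- The pairs `(v, G)` with `∫ v = 0`. -/
def zeroMean (B : BoundaryCondition d) : Submodule ℝ (L2Pair B.measure) where
  carrier := {p | ∫ x, p.fst x ∂B.measure = 0}
  zero_mem' := by
    change ∫ x, (0 : Lp ℝ 2 B.measure) x ∂B.measure = 0
    rw [integral_congr_ae (Lp.coeFn_zero ℝ 2 B.measure)]
    simp
  add_mem' := by
    intro p q hp hq
    change ∫ x, (p.fst + q.fst) x ∂B.measure = 0
    rw [integral_congr_ae (Lp.coeFn_add p.fst q.fst)]
    simp only [Pi.add_apply]
    rw [integral_add ((Lp.memLp p.fst).integrable (by norm_num))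
      ((Lp.memLp q.fst).integrable (by norm_num))]
    simp only [mem_ofPred_eq] at hp hq
    simp [hp, hq]
  smul_mem' := by
    intro c p hp
    change ∫ x, (c • p.fst) x ∂B.measure = 0
    rw [integral_congr_ae (Lp.coeFn_smul c p.fst)]
    simp only [mem_ofPred_eq] at hp
    simp [integral_const_mul, hp]

/-- The space of `H¹` functions satisfying the boundary condition, as pairs `(v, ∇v)`:
`H¹₀(Ω)`, the `H¹`-closure of `C_c^∞(Ω)`; respectively the functions of zero mean in `H¹_per`, the
`H¹`-closure of the smooth periodic functions. -/
def energySpace : (B : BoundaryCondition d) → Submodule ℝ (L2Pair B.measure)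
  | dirichlet Ω ho hb hn => (dirichlet Ω ho hb hn).smoothPairs.topologicalClosure
  | periodic b => (periodic b).smoothPairs.topologicalClosure ⊓ (periodic b).zeroMean

/-- The underlying `L²` function of an element of the energy space. -/
def toL2 (B : BoundaryCondition d) (v : B.energySpace) : Lp ℝ 2 B.measure :=
  (v : L2Pair B.measure).fst

/-- The (weak) gradient of an element of the energy space. -/
def grad (B : BoundaryCondition d) (v : B.energySpace) : Lp (Space d) 2 B.measure :=
  (v : L2Pair B.measure).snd

/-- `C` is the Poincaré constant: the least `C` with `‖v‖_{L²} ≤ C ‖∇v‖_{L²}` for all `v` in the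
energy space. -/
def IsPoincareConstant (B : BoundaryCondition d) (C : ℝ) : Prop :=
  IsLeast {C : ℝ | ∀ v : B.energySpace, ‖B.toL2 v‖ ≤ C * ‖B.grad v‖} C

end BoundaryCondition

/-- Test functions in time: `C_c^∞(0,T)`. -/
def IsTimeTest (T : ℝ) (η : ℝ → ℝ) : Prop :=
  ContDiff ℝ ∞ η ∧ HasCompactSupport η ∧ tsupport η ⊆ Ioo 0 T

/-- `g ∈ L²(0,T;X)`, in the sense of Bochner. -/
def MemL2Time {X : Type*} [NormedAddCommGroup X] (T : ℝ) (g : ℝ → X) : Prop :=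
  MemLp g 2 (volume.restrict (Ioo 0 T))

section

variable {d : ℕ} (B : BoundaryCondition d)

/-- The weak time derivative of `u` belongs to `L²(0,T;H⁻¹)`, with `H⁻¹` the dual of the energy
space: `∫ η'(t) (u(t), v)_{L²} dt = - ∫ η(t) ⟨g(t), v⟩ dt` for some `g ∈ L²(0,T;H⁻¹)`. -/
def HasTimeDerivInDual (T : ℝ) (u : ℝ → B.energySpace) : Prop :=
  ∃ g : ℝ → StrongDual ℝ B.energySpace, MemL2Time T g ∧
    ∀ (η : ℝ → ℝ) (v : B.energySpace), IsTimeTest T η →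
      ∫ t in Ioo 0 T, deriv η t * inner ℝ (B.toL2 (u t)) (B.toL2 v)
        = - ∫ t in Ioo 0 T, η t * g t v

/-- `R = u_t + ∇·f(u) - ν Δu` in the sense of distributions on `(0,T) × Ω` (periodic distributions
in the periodic case). -/
def HasResidual (ν T : ℝ) (f : ℝ → Space d) (u : ℝ → B.energySpace)
    (R : ℝ → Lp ℝ 2 B.measure) : Prop :=
  ∀ (η : ℝ → ℝ) (φ : Space d → ℝ), IsTimeTest T η → B.IsTest φ →
    ∫ t in Ioo 0 T, η t * ∫ x, R t x * φ x ∂B.measure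
      = - (∫ t in Ioo 0 T, deriv η t * ∫ x, B.toL2 (u t) x * φ x ∂B.measure)
        - (∫ t in Ioo 0 T, η t * ∫ x, inner ℝ (f (B.toL2 (u t) x)) (gradient φ x) ∂B.measure)
        + ν * ∫ t in Ioo 0 T, η t * ∫ x, inner ℝ (B.grad (u t) x) (gradient φ x) ∂B.measure

/-- `u` solves `u_t + ∇·f(u) = ν Δu` weakly, i.e. its residual vanishes. -/
def IsWeakSolution (ν T : ℝ) (f : ℝ → Space d) (u : ℝ → B.energySpace) : Prop :=
  HasResidual B ν T f u (fun _ => 0)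

/-- The (essential) range of `u` on `(0,T) × Ω`: the values `s` each of whose neighbourhoods is
attained on a set of positive measure. -/
def essRange (T : ℝ) (u : ℝ → B.energySpace) : Set ℝ :=
  {s | ∀ U ∈ 𝓝 s, ∃ᵐ t ∂(volume.restrict (Ioo 0 T)), ∃ᵐ x ∂B.measure, B.toL2 (u t) x ∈ U}

/-- The values of `‖f'‖` on the union of the ranges of `u` and `w`. -/
def speeds (T : ℝ) (f : ℝ → Space d) (u w : ℝ → B.energySpace) : Set ℝ :=
  (fun s => ‖deriv f s‖) '' (essRange B T u ∪ essRange B T w)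

/-- `U : [0,T] → L²` is the continuous representative of `u`. -/
def IsContinuousRep (T : ℝ) (u : ℝ → B.energySpace) (U : ℝ → Lp ℝ 2 B.measure) : Prop :=
  ContinuousOn U (Icc 0 T) ∧ ∀ᵐ t ∂(volume.restrict (Ioo 0 T)), U t = B.toL2 (u t)

end

end ViscousLaw

end

noncomputable section

namespace ViscousLaw

/-! ### Absolutely continuous curves in a Hilbert space. -/

section AbsolutelyContinuous

/-! The error `e = uν - u` is tested with itself. Formally, half the derivative of `‖e‖²` is `-(R,
e) + (f(uν) - f(u), ∇e) - ν‖∇e‖²`. Poincaré bounds the first term by `C_P‖R‖‖∇e‖`, a Lipschitz bound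
on the flux bounds the second by `L_f‖e‖‖∇e‖`, and Young's inequality gives each half of the
dissipation. Hence `(‖e‖²)' ≤ (L_f²/ν)‖e‖² + (C_P²/ν)‖R‖²` (`energy_density_le`). Grönwall
(`le_exp_mul_of_le_integral`) and a square root (`le_exp_mul_of_sq_le`) finish. Three points need
work.

The Lipschitz bound. `L_f` controls `f'` on `I` only, so `I` has to be convex. If a function of the
energy space avoids an open interval, a smooth step across that gap composed with it has vanishing
gradient, and Poincaré makes the composition constant (`exists_smoothStep_ae_eq`): the function
stays on one side of the gap. The boundary condition, or the zero mean, forbids it to stay above a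
positive or below a negative number (`not_ae_ge`, `not_ae_le`). So an essential range contains the
segment from `0` to each of its points, and the union is convex (`convex_essRange_union`). No
connectedness of `Ω` enters.

Testing with `e`. Extending `f` from `I` to a Lipschitz map puts the flux in `L²`
(`exists_superposition`), so the equation places the time derivatives in the dual, and a
Lions–Magenes theorem applies (`HasWeakDeriv.exists_continuousOn`). It is proved without
mollification. Let `ι : V → H` be the contraction into the pivot space and let `γ` be the Riesz
representative of the derivative. Then `ι†ι e` agrees a.e. with the absolutely continuous curve `w =
c + ∫ γ`. The partial Neumann sums `N_n` for the inverse of `ι†ι` give `N_n w = e - C^n e` with `C =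
1 - ι†ι`, and `C^n` converges strongly to the projection onto `ker ι` (`tendsto_sqDefect_pow`). For
the continuous curves `ι N_n w` the energy identity is the fundamental theorem of calculus for a
symmetric quadratic form (`inner_symm_eq_add_integral`); it survives the limit, which is uniform in
time.

The Poincaré constant. The inequality is proved for smooth functions, by integration by parts
(`poincare_dirichlet`) or by averaging over translations (`poincare_periodic`), and passes to the
closure. The admissible constants form a closed set bounded below by a positive number. -/

theorem _root_.AbsolutelyContinuousOnInterval.of_dist_le {X Y : Type*} [PseudoMetricSpace X]
    [PseudoMetricSpace Y] {f : ℝ → X} {g : ℝ → Y} {a b K : ℝ}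
    (hg : AbsolutelyContinuousOnInterval g a b)
    (h : ∀ x ∈ uIcc a b, ∀ y ∈ uIcc a b, dist (f x) (f y) ≤ K * dist (g x) (g y)) :
    AbsolutelyContinuousOnInterval f a b := by
  unfold AbsolutelyContinuousOnInterval at hg ⊢
  apply squeeze_zero' ?_ ?_ (by simpa using hg.const_mul K)
  · exact Eventually.of_forall fun _ ↦ Finset.sum_nonneg fun i hi ↦ dist_nonneg
  rw [eventually_inf_principal]
  filter_upwards with (n, I) hnI
  simp only [Finset.mul_sum]
  gcongr with i hi
  simp only [AbsolutelyContinuousOnInterval.disjWithin, mem_ofPred_eq] at hnI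
  exact h _ (hnI.left i hi).left _ (hnI.left i hi).right

/-- Increments of the integral are dominated by those of `∫ ‖γ‖`, a real absolutely continuous
function. -/
theorem absolutelyContinuousOnInterval_integral {V : Type*} [NormedAddCommGroup V]
    [NormedSpace ℝ V] {γ : ℝ → V} {T : ℝ} (hγ : IntervalIntegrable γ volume 0 T) :
    AbsolutelyContinuousOnInterval (fun t ↦ ∫ s in (0 : ℝ)..t, γ s) 0 T := by
  refine (hγ.norm.absolutelyContinuousOnInterval_intervalIntegral (c := 0) (by simp)).of_dist_le
    (K := 1) fun x hx y hy ↦ ?_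
  have hi : ∀ z ∈ uIcc 0 T, IntervalIntegrable γ volume 0 z := fun z hz ↦
    hγ.mono_set (uIcc_subset_uIcc_left hz)
  rw [one_mul, dist_eq_norm, Real.dist_eq,
    intervalIntegral.integral_interval_sub_left (hi x hx) (hi y hy),
    intervalIntegral.integral_interval_sub_left (hi x hx).norm (hi y hy).norm]
  exact intervalIntegral.norm_integral_le_abs_integral_norm

variable {V : Type*} [NormedAddCommGroup V] [InnerProductSpace ℝ V] [CompleteSpace V]

/-- The fundamental theorem of calculus for a quadratic form along an absolutely continuous
curve. -/
theorem inner_symm_eq_add_integral {T : ℝ} {γ : ℝ → V} (hT : 0 ≤ T)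
    (hγ : IntervalIntegrable γ volume 0 T) {S : V →L[ℝ] V}
    (hS : ∀ x y, inner ℝ (S x) y = inner ℝ x (S y)) (c : V) {t : ℝ} (ht : t ∈ Icc 0 T) :
    inner ℝ (S (c + ∫ s in (0 : ℝ)..t, γ s)) (c + ∫ s in (0 : ℝ)..t, γ s) =
      inner ℝ (S c) c +
        2 * ∫ s in (0 : ℝ)..t, inner ℝ (γ s) (S (c + ∫ r in (0 : ℝ)..s, γ r)) := by
  set w : ℝ → V := fun t ↦ c + ∫ s in (0 : ℝ)..t, γ s with hw
  have hW : AbsolutelyContinuousOnInterval (fun t ↦ ∫ s in (0 : ℝ)..t, γ s) 0 T :=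
    absolutelyContinuousOnInterval_integral hγ
  have hwac : AbsolutelyContinuousOnInterval w 0 T :=
    hW.of_dist_le (K := 1) fun x _ y _ ↦ by simp [hw]
  have hwc : ContinuousOn w (uIcc 0 T) := hwac.continuousOn
  obtain ⟨C, hC⟩ := hwac.exists_bound
  have hqac : AbsolutelyContinuousOnInterval (fun t ↦ inner ℝ (S (w t)) (w t)) 0 T := by
    refine hwac.of_dist_le (K := 2 * (‖S‖ * C)) fun x hx y hy ↦ ?_
    -- Symmetry of `S` factors the difference of two values of the form, which makes the form
    -- Lipschitz on bounded sets.
    have e : inner ℝ (S (w x)) (w x) - inner ℝ (S (w y)) (w y) =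
        inner ℝ (S (w x + w y)) (w x - w y) := by
      simp only [map_add, inner_add_left, inner_sub_right]
      have := (hS (w x) (w y)).trans (real_inner_comm _ _)
      linarith
    rw [Real.dist_eq, e, dist_eq_norm]
    refine (abs_real_inner_le_norm _ _).trans ?_
    gcongr
    refine (S.le_opNorm _).trans ?_
    rw [mul_left_comm]
    gcongr
    exact (norm_add_le _ _).trans (by linarith [hC x hx, hC y hy])
  have hi : IntervalIntegrable (fun s ↦ inner ℝ (γ s) (S (w s))) volume 0 T := by
    have hSc : ContinuousOn (fun s ↦ S (w s)) (uIcc 0 T) := S.continuous.comp_continuousOn hwc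
    rw [intervalIntegrable_iff] at hγ ⊢
    obtain ⟨D, hD⟩ := isCompact_uIcc.exists_bound_of_continuousOn hSc
    have hm : AEStronglyMeasurable (fun s ↦ S (w s)) (volume.restrict (uIoc 0 T)) :=
      (hSc.mono uIoc_subset_uIcc).aestronglyMeasurable measurableSet_uIoc
    refine (hγ.norm.mul_const D).mono' (hγ.1.inner hm) ?_
    filter_upwards [ae_restrict_mem measurableSet_uIoc] with s hs
    refine (norm_inner_le_norm _ _).trans ?_
    gcongr
    exact hD s (uIoc_subset_uIcc hs)
  have hIac := hi.absolutelyContinuousOnInterval_intervalIntegral (c := 0) (by simp)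
  -- The difference of the two sides is absolutely continuous with derivative zero almost
  -- everywhere, hence constant.
  have hac := hqac.fun_sub (hIac.const_mul 2)
  obtain ⟨k, hk⟩ := hac.const_of_ae_hasDerivAt_zero (by
    filter_upwards [hγ.ae_hasDerivAt_integral, hi.ae_hasDerivAt_integral] with x h1 h2 hx
    have d1 : HasDerivAt w (γ x) x := (h1 hx 0 (by simp)).const_add c
    have d2 : HasDerivAt (fun t ↦ S (w t)) (S (γ x)) x := S.hasFDerivAt.comp_hasDerivAt x d1
    have d3 := (d2.inner ℝ d1).sub ((h2 hx 0 (by simp)).const_mul 2)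
    convert! d3 using 1
    rw [hS (γ x) (w x), real_inner_comm]
    ring)
  have ht' : t ∈ uIcc 0 T := by rwa [uIcc_of_le hT]
  have e1 := hk t ht'
  have e2 := hk 0 (by simp)
  simp only [intervalIntegral.integral_same, mul_zero, sub_zero] at e2
  have e3 : w 0 = c := by simp [hw]
  rw [e3] at e2
  change inner ℝ (S (w t)) (w t) = _ + 2 * ∫ s in (0 : ℝ)..t, inner ℝ (γ s) (S (w s))
  linarith

end AbsolutelyContinuous

/-! ### Test functions in time and the du Bois-Reymond lemma. -/

section DuBoisReymond

variable {V : Type*} [NormedAddCommGroup V] [NormedSpace ℝ V] [CompleteSpace V]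

/-- Integration by parts against a test function. -/
theorem IsTimeTest.integral_deriv_smul_integral {T : ℝ} {γ : ℝ → V}
    (hγ : IntervalIntegrable γ volume 0 T) {η : ℝ → ℝ} (hη : IsTimeTest T η) :
    ∫ t in (0 : ℝ)..T, deriv η t • ∫ s in (0 : ℝ)..t, γ s = - ∫ t in (0 : ℝ)..T, η t • γ t := by
  have hW : AbsolutelyContinuousOnInterval (fun t ↦ ∫ s in (0 : ℝ)..t, γ s) 0 T :=
    absolutelyContinuousOnInterval_integral hγ
  have hηac : AbsolutelyContinuousOnInterval η 0 T :=
    (hη.1.of_le (by simp)).contDiffOn.absolutelyContinuousOnInterval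
  have hdc : Continuous (deriv η) := hη.1.continuous_deriv (by simp)
  have i1 : IntervalIntegrable (fun t ↦ deriv η t • ∫ s in (0 : ℝ)..t, γ s) volume 0 T :=
    (hdc.continuousOn.smul hW.continuousOn).intervalIntegrable
  have i2 : IntervalIntegrable (fun t ↦ η t • γ t) volume 0 T :=
    hγ.continuousOn_smul hη.1.continuous.continuousOn
  have i := i1.add i2
  have hac := (hηac.fun_smul hW).fun_sub
    (absolutelyContinuousOnInterval_integral i)
  obtain ⟨k, hk⟩ := hac.const_of_ae_hasDerivAt_zero (by
    filter_upwards [hγ.ae_hasDerivAt_integral, i.ae_hasDerivAt_integral] with x h1 h2 hx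
    have d1 := h1 hx 0 (by simp)
    have d0 : HasDerivAt η (deriv η x) x :=
      (hη.1.differentiable (by simp) x).hasDerivAt
    have d3 := (d0.smul d1).sub (h2 hx 0 (by simp))
    convert! d3 using 1
    abel_nf)
  have z : ∀ x, x ∉ Ioo 0 T → η x = 0 := fun x hx ↦
    image_eq_zero_of_notMem_tsupport fun h ↦ hx (hη.2.2 h)
  have e1 := hk T (by simp)
  have e2 := hk 0 (by simp)
  simp only [intervalIntegral.integral_same, z T (by simp), z 0 (by simp), zero_smul, sub_zero,
    zero_sub] at e1 e2
  have e3 : ∫ t in (0 : ℝ)..T, (deriv η t • ∫ s in (0 : ℝ)..t, γ s) + η t • γ t = 0 := by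
    rw [← e2] at e1; exact neg_eq_zero.1 e1
  rw [intervalIntegral.integral_add i1 i2] at e3
  exact eq_neg_of_add_eq_zero_left e3

theorem exists_isTimeTest_integral_eq_one {T : ℝ} (hT : 0 < T) :
    ∃ ρ, IsTimeTest T ρ ∧ ∫ t, ρ t = 1 := by
  let b : ContDiffBump (T / 2) := ⟨T / 8, T / 4, by linarith, by linarith⟩
  refine ⟨b.normed volume, ⟨b.contDiff_normed, b.hasCompactSupport_normed, ?_⟩,
    b.integral_normed⟩
  rw [b.tsupport_normed_eq, Real.closedBall_eq_Icc]
  intro x hx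
  have h1 : T / 2 - T / 4 ≤ x := hx.1
  have h2 : x ≤ T / 2 + T / 4 := hx.2
  constructor <;> linarith

/-- A test function with vanishing integral is the derivative of a test function. -/
theorem IsTimeTest.exists_deriv_eq {T : ℝ} {ψ : ℝ → ℝ} (hψ : IsTimeTest T ψ)
    (h0 : ∫ t, ψ t = 0) : ∃ η, IsTimeTest T η ∧ deriv η = ψ := by
  obtain ⟨hs, hc, hsub⟩ := hψ
  have hcont : Continuous ψ := hs.continuous
  have hint : ∀ a b, IntervalIntegrable ψ volume a b := fun a b ↦ hcont.intervalIntegrable a b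
  have hd : ∀ x, HasDerivAt (fun t ↦ ∫ s in (0 : ℝ)..t, ψ s) (ψ x) x := fun x ↦
    intervalIntegral.integral_hasDerivAt_right (hint _ _)
      (hcont.stronglyMeasurableAtFilter _ _) hcont.continuousAt
  have hderiv : deriv (fun t ↦ ∫ s in (0 : ℝ)..t, ψ s) = ψ := funext fun x ↦ (hd x).deriv
  have z : ∀ x, x ∉ tsupport ψ → ψ x = 0 := fun x hx ↦ image_eq_zero_of_notMem_tsupport hx
  rcases (tsupport ψ).eq_empty_or_nonempty with he | hne
  · refine ⟨0, ⟨contDiff_const, HasCompactSupport.zero, by simp [tsupport]⟩, ?_⟩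
    funext x
    rw [z x (by simp [he])]
    simp
  have hK : IsCompact (tsupport ψ) := hc
  obtain ⟨a, ha, hal⟩ := hK.exists_isLeast hne
  obtain ⟨b, hb, hbl⟩ := hK.exists_isGreatest hne
  have ha0 := hsub ha
  have hb0 := hsub hb
  have hab : a ≤ b := hal hb
  have hz1 : ∀ x, x < a → ψ x = 0 := fun x hx ↦ z x fun h ↦ absurd (hal h) (by linarith)
  have hz2 : ∀ x, b < x → ψ x = 0 := fun x hx ↦ z x fun h ↦ absurd (hbl h) (by linarith)
  have hT : 0 < T := ha0.1.trans ha0.2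
  have htot : ∫ s in (0 : ℝ)..T, ψ s = 0 := by
    rw [intervalIntegral.integral_of_le hT.le]
    refine Eq.trans ?_ h0
    refine setIntegral_eq_integral_of_forall_compl_eq_zero fun x hx ↦ z x fun h ↦ hx ?_
    exact Ioo_subset_Ioc_self (hsub h)
  -- To the left of `a` the integrand vanishes; to the right of `b` the primitive has reached the
  -- total integral, which is zero.
  have hsupp : Function.support (fun t ↦ ∫ s in (0 : ℝ)..t, ψ s) ⊆ Icc a b := by
    intro t ht
    by_contra hcon
    apply ht
    rw [mem_Icc, not_and_or, not_le, not_le] at hcon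
    rcases hcon with h | h
    · change ∫ s in (0 : ℝ)..t, ψ s = 0
      rw [intervalIntegral.integral_congr_uIoo (g := fun _ ↦ (0 : ℝ))]
      · simp
      · intro s hs
        refine hz1 s ?_
        have := hs.2
        exact this.trans (max_lt ha0.1 h)
    · change ∫ s in (0 : ℝ)..t, ψ s = 0
      rw [← intervalIntegral.integral_add_adjacent_intervals (hint 0 T) (hint T t), htot,
        zero_add, intervalIntegral.integral_congr_uIoo (g := fun _ ↦ (0 : ℝ))]
      · simp
      · intro s hs
        refine hz2 s ?_
        have := hs.1
        exact (lt_min hb0.2 h).trans this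
  refine ⟨fun t ↦ ∫ s in (0 : ℝ)..t, ψ s, ⟨?_, ?_, ?_⟩, hderiv⟩
  · rw [contDiff_infty_iff_deriv, hderiv]
    exact ⟨fun x ↦ (hd x).differentiableAt, hs⟩
  · exact HasCompactSupport.of_support_subset_isCompact isCompact_Icc hsupp
  · refine (closure_minimal hsupp isClosed_Icc).trans fun x hx ↦ ?_
    exact ⟨ha0.1.trans_le hx.1, hx.2.trans_lt hb0.2⟩

/-- A function whose weak derivative vanishes is constant. -/
theorem ae_eq_const_of_integral_deriv_smul_eq_zero {T : ℝ} (hT : 0 < T) {z : ℝ → V}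
    (hz : IntegrableOn z (Ioo 0 T))
    (h : ∀ η, IsTimeTest T η → ∫ t in Ioo 0 T, deriv η t • z t = 0) :
    ∃ c, ∀ᵐ t ∂volume.restrict (Ioo 0 T), z t = c := by
  obtain ⟨ρ, hρ, hρ1⟩ := exists_isTimeTest_integral_eq_one hT
  -- Since `ρ` has integral one, testing against `ρ` reveals the only possible constant.
  set c := ∫ t in Ioo 0 T, ρ t • z t with hc
  refine ⟨c, ?_⟩
  have hI : ∀ ψ : ℝ → ℝ, IsTimeTest T ψ → ∀ y : ℝ → V, IntegrableOn y (Ioo 0 T) →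
      IntegrableOn (fun t ↦ ψ t • y t) (Ioo 0 T) := by
    intro ψ hψ y hy
    obtain ⟨D, hD⟩ := hψ.2.1.exists_bound_of_continuous hψ.1.continuous
    exact Integrable.bdd_smul hy D hψ.1.continuous.aestronglyMeasurable
      (Eventually.of_forall hD)
  have hci : IntegrableOn (fun _ : ℝ ↦ c) (Ioo 0 T) := integrableOn_const (by simp)
  have key := isOpen_Ioo.ae_eq_zero_of_integral_contDiff_smul_eq_zero (μ := volume)
    (U := Ioo 0 T) (f := fun t ↦ z t - c) (hz.sub hci).locallyIntegrableOn ?_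
  · rw [ae_restrict_iff' measurableSet_Ioo]
    filter_upwards [key] with t ht hm using sub_eq_zero.1 (ht hm)
  intro ψ h1 h2 h3
  have hψ : IsTimeTest T ψ := ⟨h1, h2, h3⟩
  have hout : ∀ x, x ∉ Ioo 0 T → ψ x = 0 := fun x hx ↦
    image_eq_zero_of_notMem_tsupport fun h ↦ hx (h3 h)
  set m := ∫ t, ψ t with hm
  have hψi : Integrable ψ := h1.continuous.integrable_of_hasCompactSupport h2
  have hρi : Integrable ρ := hρ.1.continuous.integrable_of_hasCompactSupport hρ.2.1
  -- Removing the multiple `m ρ` leaves integral zero, so the remainder is the derivative of a test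
  -- function and the hypothesis applies to it.
  have hζ : IsTimeTest T (fun t ↦ ψ t - m * ρ t) := by
    refine ⟨h1.sub (contDiff_const.mul hρ.1), h2.sub hρ.2.1.mul_left, ?_⟩
    exact (tsupport_sub _ _).trans (union_subset h3
      ((tsupport_mul_subset_right (f := fun _ ↦ m)).trans hρ.2.2))
  obtain ⟨η, hη, hηd⟩ := hζ.exists_deriv_eq (by
    rw [integral_sub hψi (hρi.const_mul m), integral_const_mul, hρ1, mul_one, sub_self])
  have e := h η hη
  rw [hηd] at e
  have e1 : ∫ t in Ioo 0 T, ψ t • z t = m • c := by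
    have := integral_sub (hI ψ hψ z hz) ((hI ρ hρ z hz).smul m)
    simp only [Pi.smul_apply, integral_smul] at this
    rw [hc, ← sub_eq_zero, ← this, ← e]
    simp only [sub_smul, mul_smul]
  rw [← setIntegral_eq_integral_of_forall_compl_eq_zero (s := Ioo 0 T)
    (fun x hx ↦ by simp [hout x hx])]
  simp only [smul_sub]
  rw [integral_sub (hI ψ hψ z hz) (hI ψ hψ _ hci), e1, integral_smul_const,
    setIntegral_eq_integral_of_forall_compl_eq_zero hout, sub_self]

end DuBoisReymond

/-! ### Powers of `1 - ι†ι`. -/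

section DefectOperator

variable {V H : Type*} [NormedAddCommGroup V] [InnerProductSpace ℝ V] [CompleteSpace V]
  [NormedAddCommGroup H] [InnerProductSpace ℝ H] [CompleteSpace H] (ι : V →L[ℝ] H)

/-- The operator `1 - ι† ι`, the square of the defect operator of a contraction `ι`. -/
def sqDefect : V →L[ℝ] V := 1 - ContinuousLinearMap.adjoint ι ∘L ι

theorem inner_sqDefect (x y : V) :
    inner ℝ (sqDefect ι x) y = inner ℝ x y - inner ℝ (ι x) (ι y) := by
  simp [sqDefect, inner_sub_left, ContinuousLinearMap.adjoint_inner_left]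

theorem inner_one_sub_sqDefect (x y : V) :
    inner ℝ ((1 - sqDefect ι) x) y = inner ℝ (ι x) (ι y) := by
  simp [sqDefect, ContinuousLinearMap.adjoint_inner_left]

theorem inner_sqDefect_comm (x y : V) :
    inner ℝ (sqDefect ι x) y = inner ℝ x (sqDefect ι y) := by
  rw [inner_sqDefect, real_inner_comm (sqDefect ι y) x, inner_sqDefect, real_inner_comm x y,
    real_inner_comm (ι x)]

theorem inner_sqDefect_pow_comm (n : ℕ) (x y : V) :
    inner ℝ ((sqDefect ι ^ n) x) y = inner ℝ x ((sqDefect ι ^ n) y) := by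
  induction n generalizing x y with
  | zero => simp
  | succ n ih =>
    rw [pow_succ, mul_apply_eq_comp, ih, inner_sqDefect_comm,
      ← mul_apply_eq_comp, ← pow_succ', pow_succ]

theorem sqDefect_pow_add_apply (m n : ℕ) (x : V) :
    (sqDefect ι ^ (m + n)) x = (sqDefect ι ^ m) ((sqDefect ι ^ n) x) := by
  rw [pow_add, mul_apply_eq_comp]

theorem inner_sqDefect_pow_pow (m n : ℕ) (x : V) :
    inner ℝ ((sqDefect ι ^ m) x) ((sqDefect ι ^ n) x) =
      inner ℝ ((sqDefect ι ^ (n + m)) x) x := by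
  rw [← inner_sqDefect_pow_comm, ← sqDefect_pow_add_apply]

variable {ι}

/-- Expanding the square gives `‖x‖² - 2‖ιx‖² + ‖ι†ιx‖²`, and the last term is at most `‖ιx‖²`. -/
theorem norm_sqDefect_sq_le (hι : ∀ v, ‖ι v‖ ≤ ‖v‖) (x : V) :
    ‖sqDefect ι x‖ ^ 2 ≤ inner ℝ (sqDefect ι x) x := by
  have h1 : ‖ι‖ ≤ 1 := ι.opNorm_le_bound zero_le_one fun v ↦ by simpa using hι v
  have h2 : ‖ContinuousLinearMap.adjoint ι (ι x)‖ ≤ ‖ι x‖ := by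
    refine ((ContinuousLinearMap.adjoint ι).le_opNorm _).trans ?_
    rw [LinearIsometryEquiv.norm_map]
    exact mul_le_of_le_one_left (norm_nonneg _) h1
  have h3 : ‖ContinuousLinearMap.adjoint ι (ι x)‖ ^ 2 ≤ ‖ι x‖ ^ 2 := by gcongr
  have h4 : inner ℝ x (ContinuousLinearMap.adjoint ι (ι x)) = ‖ι x‖ ^ 2 := by
    rw [ContinuousLinearMap.adjoint_inner_right, real_inner_self_eq_norm_sq]
  rw [inner_sqDefect, real_inner_self_eq_norm_sq, real_inner_self_eq_norm_sq]
  have h5 : sqDefect ι x = x - ContinuousLinearMap.adjoint ι (ι x) := by simp [sqDefect]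
  rw [h5, norm_sub_sq_real, h4]
  linarith

theorem norm_sqDefect_le (hι : ∀ v, ‖ι v‖ ≤ ‖v‖) (x : V) : ‖sqDefect ι x‖ ≤ ‖x‖ := by
  have h1 := norm_sqDefect_sq_le hι x
  rw [inner_sqDefect, real_inner_self_eq_norm_sq, real_inner_self_eq_norm_sq] at h1
  exact (pow_le_pow_iff_left₀ (norm_nonneg _) (norm_nonneg _) two_ne_zero).1
    (h1.trans (sub_le_self _ (sq_nonneg _)))

theorem norm_sqDefect_pow_le (hι : ∀ v, ‖ι v‖ ≤ ‖v‖) (n : ℕ) (x : V) :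
    ‖(sqDefect ι ^ n) x‖ ≤ ‖x‖ := by
  induction n with
  | zero => simp
  | succ n ih =>
    rw [pow_succ', mul_apply_eq_comp]
    exact (norm_sqDefect_le hι _).trans ih

/-- With `y = C^m x`, the steps are `⟨Cy, y⟩ ≤ ‖y‖²` from an even exponent and `‖Cy‖² ≤ ⟨Cy, y⟩`
from an odd one. This replaces the spectral theorem. -/
theorem antitone_inner_sqDefect_pow (hι : ∀ v, ‖ι v‖ ≤ ‖v‖) (x : V) :
    Antitone fun n : ℕ ↦ inner ℝ ((sqDefect ι ^ n) x) x := by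
  refine antitone_nat_of_succ_le fun n ↦ ?_
  rcases Nat.even_or_odd' n with ⟨m, rfl | rfl⟩
  · rw [show 2 * m + 1 = m + (m + 1) by ring, two_mul, ← inner_sqDefect_pow_pow,
      ← inner_sqDefect_pow_pow, pow_succ', mul_apply_eq_comp, inner_sqDefect, sub_le_self_iff]
    exact real_inner_self_nonneg
  · rw [show 2 * m + 1 + 1 = (m + 1) + (m + 1) by ring, show 2 * m + 1 = m + (m + 1) by ring,
      ← inner_sqDefect_pow_pow, ← inner_sqDefect_pow_pow, pow_succ', mul_apply_eq_comp,
      real_inner_self_eq_norm_sq]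
    exact norm_sqDefect_sq_le hι _

/-- The powers of `1 - ι† ι` converge strongly to the projection onto the kernel of `ι`. -/
theorem tendsto_sqDefect_pow (hι : ∀ v, ‖ι v‖ ≤ ‖v‖) (x : V) :
    Tendsto (fun n : ℕ ↦ (sqDefect ι ^ n) x) atTop
      (𝓝 ((LinearMap.ker ι.toLinearMap).starProjection x)) := by
  have hbdd : BddBelow (range fun n : ℕ ↦ inner ℝ ((sqDefect ι ^ n) x) x) := by
    refine ⟨-(‖x‖ * ‖x‖), ?_⟩
    rintro _ ⟨n, rfl⟩
    have h1 := abs_real_inner_le_norm ((sqDefect ι ^ n) x) x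
    have h2 := mul_le_mul_of_nonneg_right (norm_sqDefect_pow_le hι n x) (norm_nonneg x)
    exact (abs_le.1 (h1.trans h2)).1
  have hlim := tendsto_atTop_ciInf (antitone_inner_sqDefect_pow hι x) hbdd
  set l := ⨅ n : ℕ, inner ℝ ((sqDefect ι ^ n) x) x
  -- The square `‖C^m x - C^n x‖²` is a combination of the moments `⟨C^k x, x⟩` for `k = 2m, 2n, m +
  -- n`, all close to the same limit `l`.
  have hcau : CauchySeq fun n : ℕ ↦ (sqDefect ι ^ n) x := by
    rw [Metric.cauchySeq_iff]
    intro ε hε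
    obtain ⟨N, hN⟩ := Metric.tendsto_atTop.1 hlim (ε ^ 2 / 4) (by positivity)
    refine ⟨N, fun m hm n hn ↦ ?_⟩
    have h0 : ∀ a b : ℕ, N ≤ a → |inner ℝ ((sqDefect ι ^ (a + b)) x) x - l| < ε ^ 2 / 4 :=
      fun a b h ↦ hN _ (by omega)
    have h1 := abs_lt.1 (h0 m m hm)
    have h2 := abs_lt.1 (h0 n n hn)
    have h3 := abs_lt.1 (h0 n m hn)
    have h4 : ‖(sqDefect ι ^ m) x - (sqDefect ι ^ n) x‖ ^ 2 < ε ^ 2 := by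
      rw [norm_sub_sq_real, ← real_inner_self_eq_norm_sq, ← real_inner_self_eq_norm_sq,
        inner_sqDefect_pow_pow,
        inner_sqDefect_pow_pow, inner_sqDefect_pow_pow]
      linarith [h1.2, h2.2, h3.1]
    rw [dist_eq_norm]
    exact lt_of_pow_lt_pow_left₀ 2 hε.le h4
  obtain ⟨z, hz⟩ := cauchySeq_tendsto_of_complete hcau
  have hfix : sqDefect ι z = z := by
    refine tendsto_nhds_unique (((sqDefect ι).continuous.tendsto z).comp hz) ?_
    refine (hz.comp (tendsto_add_atTop_nat 1)).congr fun n ↦ ?_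
    change (sqDefect ι ^ (n + 1)) x = sqDefect ι ((sqDefect ι ^ n) x)
    rw [pow_succ', mul_apply_eq_comp]
  have hker : ∀ k ∈ LinearMap.ker ι.toLinearMap, ∀ n : ℕ, (sqDefect ι ^ n) k = k := by
    intro k hk n
    have h1 : sqDefect ι k = k := by
      have : ι k = 0 := hk
      simp [sqDefect, this]
    induction n with
    | zero => simp
    | succ n ih => rw [pow_succ, mul_apply_eq_comp, h1, ih]
  have hzk : z ∈ LinearMap.ker ι.toLinearMap := by
    have h1 := inner_sqDefect ι z z
    rw [hfix, real_inner_self_eq_norm_sq, real_inner_self_eq_norm_sq] at h1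
    have h2 : ‖ι z‖ ^ 2 = 0 := by linarith
    have : ι z = 0 := by simpa using h2
    exact this
  rw [Submodule.eq_starProjection_of_mem_of_inner_eq_zero hzk fun k hk ↦ ?_]
  · exact hz
  -- Powers of `C` are symmetric and fix the kernel, so `x - C^n x` is orthogonal to it for every
  -- `n`.
  have h1 : Tendsto (fun n : ℕ ↦ inner ℝ (x - (sqDefect ι ^ n) x) k) atTop
      (𝓝 (inner ℝ (x - z) k)) := (tendsto_const_nhds.sub hz).inner tendsto_const_nhds
  refine tendsto_nhds_unique h1 ?_
  refine tendsto_const_nhds.congr fun n ↦ ?_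
  rw [inner_sub_left, inner_sqDefect_pow_comm, hker k hk, sub_self]

end DefectOperator

/-! ### Weak derivatives in the dual and Neumann sums. -/

section EnergyIdentity

variable {V H : Type*} [NormedAddCommGroup V] [InnerProductSpace ℝ V] [CompleteSpace V]
  [NormedAddCommGroup H] [InnerProductSpace ℝ H] [CompleteSpace H]

/-- `γ ∈ L²(0,T;V)` represents the weak derivative of `ι e` in the dual of `V`. -/
def HasWeakDeriv (T : ℝ) (ι : V →L[ℝ] H) (e γ : ℝ → V) : Prop :=
  ∀ (η : ℝ → ℝ) (v : V), IsTimeTest T η →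
    ∫ t in Ioo 0 T, deriv η t * inner ℝ (ι (e t)) (ι v) =
      -∫ t in Ioo 0 T, η t * inner ℝ (γ t) v

theorem MemL2Time.integrableOn {X : Type*} [NormedAddCommGroup X] {T : ℝ} {g : ℝ → X}
    (hg : MemL2Time T g) : IntegrableOn g (Ioo 0 T) :=
  MemLp.integrable (by norm_num) hg

theorem MemL2Time.clm {X Y : Type*} [NormedAddCommGroup X] [NormedSpace ℝ X]
    [NormedAddCommGroup Y] [NormedSpace ℝ Y] {T : ℝ} {g : ℝ → X} (hg : MemL2Time T g)
    (A : X →L[ℝ] Y) : MemL2Time T fun t ↦ A (g t) :=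
  A.comp_memLp' hg

theorem IsTimeTest.deriv {T : ℝ} {η : ℝ → ℝ} (hη : IsTimeTest T η) : IsTimeTest T (deriv η) :=
  ⟨((contDiff_infty_iff_deriv.1 hη.1).2), hη.2.1.deriv, (tsupport_deriv_subset).trans hη.2.2⟩

theorem IsTimeTest.integrableOn_smul {T : ℝ} {ψ : ℝ → ℝ} (hψ : IsTimeTest T ψ)
    {X : Type*} [NormedAddCommGroup X] [NormedSpace ℝ X] {y : ℝ → X}
    (hy : IntegrableOn y (Ioo 0 T)) : IntegrableOn (fun t ↦ ψ t • y t) (Ioo 0 T) := by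
  obtain ⟨D, hD⟩ := hψ.2.1.exists_bound_of_continuous hψ.1.continuous
  exact Integrable.bdd_smul hy D hψ.1.continuous.aestronglyMeasurable (Eventually.of_forall hD)

/-- Moving `ι` across by its adjoint turns the scalar identities into one identity in `V`, to which
the du Bois-Reymond lemma applies. -/
theorem HasWeakDeriv.integral_deriv_smul {T : ℝ} {ι : V →L[ℝ] H} {e γ : ℝ → V}
    (he : MemL2Time T e) (hγ : MemL2Time T γ) (h : HasWeakDeriv T ι e γ) {η : ℝ → ℝ}
    (hη : IsTimeTest T η) :
    ∫ t in Ioo 0 T, deriv η t • (1 - sqDefect ι) (e t) = -∫ t in Ioo 0 T, η t • γ t := by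
  refine ext_inner_left ℝ fun v ↦ ?_
  rw [inner_neg_right, ← integral_inner (hη.deriv.integrableOn_smul (he.clm _).integrableOn),
    ← integral_inner (hη.integrableOn_smul hγ.integrableOn)]
  simp only [inner_smul_right]
  simp only [real_inner_comm _ v, inner_one_sub_sqDefect]
  exact h η v hη

theorem restrict_Ioc_eq_restrict_Ioo (T : ℝ) :
    volume.restrict (Ioc 0 T) = volume.restrict (Ioo 0 T) :=
  (restrict_Ioo_eq_restrict_Ioc).symm

/-- A function with a weak derivative in the dual agrees, in the dual, with the integral of its
derivative. -/
theorem HasWeakDeriv.exists_eq_add_integral {T : ℝ} (hT : 0 < T) {ι : V →L[ℝ] H} {e γ : ℝ → V}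
    (he : MemL2Time T e) (hγ : MemL2Time T γ) (h : HasWeakDeriv T ι e γ) :
    ∃ c, ∀ᵐ t ∂volume.restrict (Ioo 0 T),
      (1 - sqDefect ι) (e t) = c + ∫ s in (0 : ℝ)..t, γ s := by
  have hγi : IntervalIntegrable γ volume 0 T :=
    (intervalIntegrable_iff_integrableOn_Ioo_of_le hT.le).2 hγ.integrableOn
  have hWc : ContinuousOn (fun t ↦ ∫ s in (0 : ℝ)..t, γ s) (uIcc 0 T) :=
    (absolutelyContinuousOnInterval_integral hγi).continuousOn
  have hWi : IntegrableOn (fun t ↦ ∫ s in (0 : ℝ)..t, γ s) (Ioo 0 T) :=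
    (intervalIntegrable_iff_integrableOn_Ioo_of_le hT.le).1 hWc.intervalIntegrable
  have hei := (he.clm (1 - sqDefect ι)).integrableOn
  obtain ⟨c, hc⟩ := ae_eq_const_of_integral_deriv_smul_eq_zero hT (hei.sub hWi) (by
    intro η hη
    have h1 := hη.integral_deriv_smul_integral hγi
    rw [intervalIntegral.integral_of_le hT.le, intervalIntegral.integral_of_le hT.le,
      restrict_Ioc_eq_restrict_Ioo] at h1
    simp only [Pi.sub_apply, smul_sub]
    rw [integral_sub (hη.deriv.integrableOn_smul hei) (hη.deriv.integrableOn_smul hWi), h1,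
      h.integral_deriv_smul he hγ hη, sub_self])
  refine ⟨c, hc.mono fun t ht ↦ ?_⟩
  rw [← ht]
  simp

/-- A test vector in `ker ι` annihilates the left side of the weak formulation. This is what spares
the energy identity any injectivity assumption on `ι`. -/
theorem HasWeakDeriv.starProjection_ae_eq_zero {H : Type*} [NormedAddCommGroup H]
    [InnerProductSpace ℝ H] {T : ℝ} {ι : V →L[ℝ] H} {e γ : ℝ → V} (hγ : MemL2Time T γ) (h : HasWeakDeriv T ι e γ) :
    ∀ᵐ t ∂volume.restrict (Ioo 0 T), (LinearMap.ker ι.toLinearMap).starProjection (γ t) = 0 := by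
  have hPi := (hγ.clm (LinearMap.ker ι.toLinearMap).starProjection).integrableOn
  rw [ae_restrict_iff' measurableSet_Ioo]
  refine isOpen_Ioo.ae_eq_zero_of_integral_contDiff_smul_eq_zero
    hPi.locallyIntegrableOn fun η h1 h2 h3 ↦ ?_
  have hη : IsTimeTest T η := ⟨h1, h2, h3⟩
  rw [← setIntegral_eq_integral_of_forall_compl_eq_zero (s := Ioo 0 T) (fun x hx ↦ by
    rw [image_eq_zero_of_notMem_tsupport fun h ↦ hx (h3 h), zero_smul])]
  refine ext_inner_left ℝ fun v ↦ ?_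
  rw [← integral_inner (hη.integrableOn_smul hPi), inner_zero_right]
  have h4 := h η ((LinearMap.ker ι.toLinearMap).starProjection v) hη
  have h5 : ι ((LinearMap.ker ι.toLinearMap).starProjection v) = 0 :=
    (LinearMap.ker ι.toLinearMap).starProjection_apply_mem v
  simp only [h5, inner_zero_right, mul_zero, integral_zero] at h4
  simp only [inner_smul_right]
  simp only [real_inner_comm _ v, Submodule.inner_starProjection_left_eq_right]
  linarith

variable {ι : V →L[ℝ] H}

/-- The truncated Neumann series `∑_{k<n} (1 - ι† ι)^k` for the inverse of `ι† ι`. -/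
def neumannSum (ι : V →L[ℝ] H) (n : ℕ) : V →L[ℝ] V := ∑ k ∈ Finset.range n, sqDefect ι ^ k

theorem inner_neumannSum_comm (n : ℕ) (x y : V) :
    inner ℝ (neumannSum ι n x) y = inner ℝ x (neumannSum ι n y) := by
  simp only [neumannSum, sum_apply, sum_inner, inner_sum,
    inner_sqDefect_pow_comm]

theorem neumannSum_one_sub (n : ℕ) (x : V) :
    neumannSum ι n ((1 - sqDefect ι) x) = x - (sqDefect ι ^ n) x := by
  rw [← mul_apply_eq_comp, neumannSum, geom_sum_mul_neg]
  rfl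

theorem one_sub_neumannSum (n : ℕ) (x : V) :
    (1 - sqDefect ι) (neumannSum ι n x) = x - (sqDefect ι ^ n) x := by
  rw [← mul_apply_eq_comp, neumannSum, mul_neg_geom_sum]
  rfl

theorem neumannSum_sqDefect_pow (n m : ℕ) (x : V) :
    neumannSum ι n ((sqDefect ι ^ m) x) = (sqDefect ι ^ m) (neumannSum ι n x) := by
  rw [← mul_apply_eq_comp, ← mul_apply_eq_comp]
  congr 1
  exact (Commute.sum_left _ _ _ fun k _ ↦ (Commute.refl (sqDefect ι)).pow_pow k m).eq

/-- Because `ι†ι N_n = 1 - C^n`, the squared norm becomes a form with the symmetric operator `N_n (1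
- C^n)`, as `inner_symm_eq_add_integral` requires. -/
theorem norm_sq_apply_neumannSum (n : ℕ) (x : V) :
    ‖ι (neumannSum ι n x)‖ ^ 2 =
      inner ℝ (neumannSum ι n (x - (sqDefect ι ^ n) x)) x := by
  rw [← real_inner_self_eq_norm_sq, ← inner_one_sub_sqDefect, one_sub_neumannSum,
    inner_neumannSum_comm]

theorem norm_sq_apply_neumannSum_sub (n m : ℕ) (x : V) :
    ‖ι (neumannSum ι n x - neumannSum ι m x)‖ ^ 2 =
      inner ℝ ((sqDefect ι ^ m - sqDefect ι ^ n) ((neumannSum ι n - neumannSum ι m) x)) x := by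
  rw [← real_inner_self_eq_norm_sq, ← inner_one_sub_sqDefect, map_sub, one_sub_neumannSum,
    one_sub_neumannSum]
  simp only [sub_apply, map_sub, inner_sub_left, inner_sub_right,
    ← inner_neumannSum_comm, neumannSum_sqDefect_pow]
  ring

end EnergyIdentity

/-! ### The Lions–Magenes theorem. -/

section EnergyIdentityMain

variable {V H : Type*} [NormedAddCommGroup V] [InnerProductSpace ℝ V] [CompleteSpace V]
  [NormedAddCommGroup H] [InnerProductSpace ℝ H] [CompleteSpace H]

theorem norm_integral_le_setIntegral_Ioo {X : Type*} [NormedAddCommGroup X] [NormedSpace ℝ X]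
    {T : ℝ} {g : ℝ → X} {G : ℝ → ℝ} (hG : IntegrableOn G (Ioo 0 T))
    (h : ∀ᵐ s ∂volume.restrict (Ioo 0 T), ‖g s‖ ≤ G s) {t : ℝ} (ht : t ∈ Icc 0 T) :
    ‖∫ s in (0 : ℝ)..t, g s‖ ≤ ∫ s in Ioo 0 T, G s := by
  rw [← restrict_Ioc_eq_restrict_Ioo] at h ⊢
  rw [IntegrableOn, ← restrict_Ioc_eq_restrict_Ioo] at hG
  rw [intervalIntegral.integral_of_le ht.1]
  have hsub : Ioc 0 t ⊆ Ioc 0 T := Ioc_subset_Ioc_right ht.2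
  have h' := ae_restrict_of_ae_restrict_of_subset hsub h
  refine (norm_integral_le_of_norm_le (IntegrableOn.mono_set hG hsub) h').trans ?_
  exact setIntegral_mono_set hG (h.mono fun s hs ↦ (norm_nonneg _).trans hs)
    hsub.eventuallyLE

theorem MemL2Time.integrableOn_norm_mul_norm {X Y : Type*} [NormedAddCommGroup X]
    [NormedAddCommGroup Y] {T : ℝ} {g : ℝ → X} {k : ℝ → Y} (hg : MemL2Time T g)
    (hk : MemL2Time T k) : IntegrableOn (fun t ↦ ‖g t‖ * ‖k t‖) (Ioo 0 T) :=
  MemLp.integrable_mul (p := 2) (q := 2) (MemLp.norm hg) (MemLp.norm hk)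

/-- Bounds that imply convergence, uniformly on a set. -/
theorem uniformCauchySeqOn_of_norm_sq_le {α X : Type*} [NormedAddCommGroup X] {F : ℕ → α → X}
    {s : Set α} {b : ℕ → ℝ} {r : ℕ → ℝ} (hb : Tendsto b atTop (𝓝 0)) (hr : Tendsto r atTop (𝓝 0))
    (h : ∀ n m, ∀ x ∈ s, ‖F n x - F m x‖ ^ 2 ≤ (b n + b m) ^ 2 + (r n + r m)) :
    UniformCauchySeqOn F atTop s := by
  rw [Metric.uniformCauchySeqOn_iff]
  intro ε hε
  have h1 : ∀ᶠ n in atTop, |b n| < ε / 4 := by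
    have := hb.abs
    rw [abs_zero] at this
    exact this.eventually_lt_const (by positivity)
  have h2 : ∀ᶠ n in atTop, r n < ε ^ 2 / 4 := hr.eventually_lt_const (by positivity)
  obtain ⟨N, hN⟩ := eventually_atTop.1 (h1.and h2)
  refine ⟨N, fun m hm n hn x hx ↦ ?_⟩
  have h3 := h m n x hx
  have h4 := abs_lt.1 (hN m hm).1
  have h5 := abs_lt.1 (hN n hn).1
  have h6 : (b m + b n) ^ 2 ≤ (ε / 2) ^ 2 := sq_le_sq' (by linarith) (by linarith)
  have h7 := (hN m hm).2
  have h8 := (hN n hn).2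
  rw [dist_eq_norm]
  refine lt_of_pow_lt_pow_left₀ 2 hε.le ?_
  nlinarith

/-- Lions–Magenes: a function in `L²(0,T;V)` whose weak derivative lies in the dual of `V` has a
continuous representative with values in the pivot space, for which the energy identity holds. -/
theorem HasWeakDeriv.exists_continuousOn {T : ℝ} (hT : 0 < T) {ι : V →L[ℝ] H}
    (hι : ∀ v, ‖ι v‖ ≤ ‖v‖) {e γ : ℝ → V} (he : MemL2Time T e) (hγ : MemL2Time T γ)
    (h : HasWeakDeriv T ι e γ) :
    ∃ E : ℝ → H, ContinuousOn E (Icc 0 T) ∧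
      (∀ᵐ t ∂volume.restrict (Ioo 0 T), E t = ι (e t)) ∧
      ∀ t ∈ Icc 0 T, ‖E t‖ ^ 2 = ‖E 0‖ ^ 2 + 2 * ∫ s in (0 : ℝ)..t, inner ℝ (γ s) (e s) := by
  have hγi : IntervalIntegrable γ volume 0 T :=
    (intervalIntegrable_iff_integrableOn_Ioo_of_le hT.le).2 hγ.integrableOn
  obtain ⟨c, hc⟩ := h.exists_eq_add_integral hT he hγ
  set w : ℝ → V := fun t ↦ c + ∫ s in (0 : ℝ)..t, γ s with hw
  have hw0 : w 0 = c := by simp [hw]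
  have hwc : ContinuousOn w (Icc 0 T) := by
    rw [← uIcc_of_le hT.le]
    exact continuousOn_const.add (absolutelyContinuousOnInterval_integral hγi).continuousOn
  set C := sqDefect ι with hC
  set P := (LinearMap.ker ι.toLinearMap).starProjection with hP
  set N : ℕ → V →L[ℝ] V := neumannSum ι with hN
  have hNw : ∀ᵐ t ∂volume.restrict (Ioo 0 T), ∀ n, N n (w t) = e t - (C ^ n) (e t) :=
    hc.mono fun t ht n ↦ by
      rw [hw]
      simp only
      rw [← ht, neumannSum_one_sub]
  -- The distance from `C^n e` to its limit: it tends to zero pointwise and controls every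
  -- difference `N n w - N m w`.
  set a : ℕ → ℝ → ℝ := fun n t ↦ ‖P (e t) - (C ^ n) (e t)‖ with ha
  have ha0 : ∀ t, Tendsto (fun n ↦ a n t) atTop (𝓝 0) := fun t ↦ by
    have := ((tendsto_const_nhds (x := P (e t))).sub (tendsto_sqDefect_pow hι (e t))).norm
    simpa [ha, hP, hC] using this
  have haL : ∀ n, MemL2Time T fun t ↦ P (e t) - (C ^ n) (e t) := fun n ↦
    he.clm (P - C ^ n)
  have hPle : ∀ v, ‖P v‖ ≤ ‖v‖ := fun v ↦ Submodule.norm_starProjection_apply_le _ v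
  have hab : ∀ n t, a n t ≤ 2 * ‖e t‖ := fun n t ↦
    (norm_sub_le _ _).trans (by linarith [hPle (e t), norm_sqDefect_pow_le hι n (e t)])
  have hγe := hγ.integrableOn_norm_mul_norm he
  have hγa : ∀ n, IntegrableOn (fun t ↦ ‖γ t‖ * a n t) (Ioo 0 T) := fun n ↦
    hγ.integrableOn_norm_mul_norm (haL n)
  set ε : ℕ → ℝ := fun n ↦ ∫ t in Ioo 0 T, ‖γ t‖ * a n t with hε
  have hε0 : Tendsto ε atTop (𝓝 0) := by
    have := tendsto_integral_of_dominated_convergence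
      (μ := volume.restrict (Ioo 0 T)) (F := fun n t ↦ ‖γ t‖ * a n t) (f := fun _ ↦ 0)
      (fun t ↦ 2 * (‖γ t‖ * ‖e t‖)) (fun n ↦ (hγa n).1) (Integrable.const_mul hγe 2)
      (fun n ↦ Eventually.of_forall fun t ↦ by
        rw [Real.norm_of_nonneg (mul_nonneg (norm_nonneg _) (norm_nonneg _))]
        nlinarith [hab n t, norm_nonneg (γ t)])
      (Eventually.of_forall fun t ↦ by simpa using (ha0 t).const_mul ‖γ t‖)
    simpa using this
  -- a reference time at which the equation holds
  obtain ⟨s₀, hs₀, hs₀N⟩ : ∃ s ∈ Icc 0 T, ∀ n, N n (w s) = e s - (C ^ n) (e s) := by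
    have hne : NeZero (volume.restrict (Ioo 0 T)) :=
      ⟨by simpa [Measure.restrict_eq_zero] using hT⟩
    obtain ⟨s, hs1, hs2⟩ := (hNw.and (ae_restrict_mem measurableSet_Ioo)).exists
    exact ⟨s, Ioo_subset_Icc_self hs2, hs1⟩
  have hdiff : ∀ n m t, (∀ n, N n (w t) = e t - (C ^ n) (e t)) →
      ‖N n (w t) - N m (w t)‖ ≤ a n t + a m t := by
    intro n m t ht
    rw [ht, ht]
    have : e t - (C ^ n) (e t) - (e t - (C ^ m) (e t)) =
      (P (e t) - (C ^ n) (e t)) - (P (e t) - (C ^ m) (e t)) := by abel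
    rw [this]
    exact norm_sub_le _ _
  -- The energy identity for `(N n - N m) w` compares time `t` with the reference time `s₀`. Two
  -- time integrals, each bounded by `2 (ε n + ε m)` and carrying a factor `2`, give the constant
  -- `8`.
  have hcauchy : UniformCauchySeqOn (fun n t ↦ ι (N n (w t))) atTop (Icc 0 T) := by
    refine uniformCauchySeqOn_of_norm_sq_le (ha0 s₀)
      (by simpa using hε0.const_mul 8) fun n m t ht ↦ ?_
    have hS : ∀ x y, inner ℝ (((C ^ m - C ^ n) * (N n - N m)) x) y =
        inner ℝ x (((C ^ m - C ^ n) * (N n - N m)) y) := by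
      intro x y
      simp only [mul_apply_eq_comp, sub_apply, map_sub, inner_sub_left, inner_sub_right, hC, hN,
        inner_sqDefect_pow_comm, inner_neumannSum_comm, neumannSum_sqDefect_pow]
    have hq : ∀ r ∈ Icc 0 T, ‖ι (N n (w r) - N m (w r))‖ ^ 2 =
        inner ℝ (((C ^ m - C ^ n) * (N n - N m)) c) c +
        2 * ∫ s in (0 : ℝ)..r, inner ℝ (γ s) (((C ^ m - C ^ n) * (N n - N m)) (w s)) :=
      fun r hr ↦ (norm_sq_apply_neumannSum_sub n m (w r)).trans
        (inner_symm_eq_add_integral hT.le hγi hS c hr)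
    have hbound : ∀ r ∈ Icc 0 T,
        |∫ s in (0 : ℝ)..r, inner ℝ (γ s) (((C ^ m - C ^ n) * (N n - N m)) (w s))| ≤
          2 * (ε n + ε m) := by
      intro r hr
      have hG : IntegrableOn (fun t ↦ 2 * (‖γ t‖ * a n t + ‖γ t‖ * a m t)) (Ioo 0 T) :=
        Integrable.const_mul ((hγa n).add (hγa m)) 2
      rw [← Real.norm_eq_abs]
      refine (norm_integral_le_setIntegral_Ioo hG ?_ hr).trans_eq ?_
      · filter_upwards [hNw] with s hs
        have h1 := hdiff n m s hs
        have h2 : ‖((C ^ m - C ^ n) * (N n - N m)) (w s)‖ ≤ 2 * ‖N n (w s) - N m (w s)‖ := by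
          rw [mul_apply_eq_comp, sub_apply, sub_apply]
          exact (norm_sub_le _ _).trans (by
            linarith [norm_sqDefect_pow_le hι m (N n (w s) - N m (w s)),
              norm_sqDefect_pow_le hι n (N n (w s) - N m (w s))])
        refine (norm_inner_le_norm _ _).trans ?_
        nlinarith [norm_nonneg (γ s)]
      · rw [integral_const_mul, integral_add (hγa n) (hγa m)]
    have h1 := hq t ht
    have h2 := hq s₀ hs₀
    have h3 := abs_le.1 (hbound t ht)
    have h4 := abs_le.1 (hbound s₀ hs₀)
    have h5 : ‖ι (N n (w s₀) - N m (w s₀))‖ ^ 2 ≤ (a n s₀ + a m s₀) ^ 2 := by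
      gcongr
      exact (hι _).trans (hdiff n m s₀ hs₀N)
    rw [← map_sub]
    linarith [h3.2, h4.1]
  -- the limit
  have hlim : ∀ t, ∃ x, t ∈ Icc 0 T → Tendsto (fun n ↦ ι (N n (w t))) atTop (𝓝 x) := by
    intro t
    by_cases ht : t ∈ Icc 0 T
    · obtain ⟨x, hx⟩ := cauchySeq_tendsto_of_complete (hcauchy.cauchySeq ht)
      exact ⟨x, fun _ ↦ hx⟩
    · exact ⟨0, fun h ↦ absurd h ht⟩
  choose E hE using hlim
  have hunif : TendstoUniformlyOn (fun n t ↦ ι (N n (w t))) E atTop (Icc 0 T) :=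
    hcauchy.tendstoUniformlyOn_of_tendsto fun t ht ↦ hE t ht
  have hPa : ∀ᵐ t ∂volume.restrict (Ioo 0 T), P (γ t) = 0 := h.starProjection_ae_eq_zero hγ
  refine ⟨E, ?_, ?_, fun t ht ↦ ?_⟩
  · exact hunif.continuousOn (Frequently.of_forall fun n ↦
      (ι.continuous.comp (N n).continuous).comp_continuousOn hwc)
  · filter_upwards [hNw, ae_restrict_mem measurableSet_Ioo] with t ht htm
    refine tendsto_nhds_unique (hE t (Ioo_subset_Icc_self htm)) ?_
    simp only [ht]
    have h1 := (ι.continuous.tendsto _).comp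
      ((tendsto_const_nhds (x := e t)).sub (tendsto_sqDefect_pow hι (e t)))
    have h2 : ι (P (e t)) = 0 := (LinearMap.ker ι.toLinearMap).starProjection_apply_mem (e t)
    rw [map_sub, h2, sub_zero] at h1
    exact h1
  -- The approximate identity; almost everywhere, `N n (1 - C ^ n) w` equals `(1 - C ^ n)² e`.
  · have hid : ∀ n, ‖ι (N n (w t))‖ ^ 2 = ‖ι (N n (w 0))‖ ^ 2 +
        2 * ∫ s in (0 : ℝ)..t, inner ℝ (γ s) ((N n * (1 - C ^ n)) (w s)) := by
      intro n
      have hS : ∀ x y, inner ℝ ((N n * (1 - C ^ n)) x) y = inner ℝ x ((N n * (1 - C ^ n)) y) := by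
        intro x y
        simp only [mul_apply_eq_comp, sub_apply, map_sub, inner_sub_left, inner_sub_right, hC, hN,
          inner_sqDefect_pow_comm, inner_neumannSum_comm, neumannSum_sqDefect_pow,
          one_apply_eq_self]
      have := inner_symm_eq_add_integral hT.le hγi hS c ht
      rw [norm_sq_apply_neumannSum, norm_sq_apply_neumannSum, hw0]
      exact this
    have hI : Tendsto (fun n ↦ ∫ s in (0 : ℝ)..t, inner ℝ (γ s) ((N n * (1 - C ^ n)) (w s)))
        atTop (𝓝 (∫ s in (0 : ℝ)..t, inner ℝ (γ s) (e s))) := by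
      have hsub : Ioc 0 t ⊆ Ioc 0 T := Ioc_subset_Ioc_right ht.2
      have hle : ∀ {p : ℝ → Prop}, (∀ᵐ s ∂volume.restrict (Ioo 0 T), p s) →
          ∀ᵐ s ∂volume.restrict (Ioc 0 t), p s := fun {p} hp ↦ by
        rw [← restrict_Ioc_eq_restrict_Ioo] at hp
        exact ae_restrict_of_ae_restrict_of_subset hsub hp
      have hle' : ∀ {g : ℝ → ℝ}, IntegrableOn g (Ioo 0 T) → IntegrableOn g (Ioc 0 t) :=
        fun {g} hg ↦ by
          rw [IntegrableOn, ← restrict_Ioc_eq_restrict_Ioo] at hg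
          exact IntegrableOn.mono_set hg hsub
      rw [intervalIntegral.integral_of_le ht.1]
      simp only [intervalIntegral.integral_of_le ht.1]
      have heq : ∀ᵐ s ∂volume.restrict (Ioo 0 T), ∀ n, (N n * (1 - C ^ n)) (w s) =
          e s - (C ^ n) (e s) - (C ^ n) (e s - (C ^ n) (e s)) := hNw.mono fun s hs n ↦ by
        rw [mul_apply_eq_comp, sub_apply, one_apply_eq_self, map_sub]
        change neumannSum ι n (w s) - neumannSum ι n ((sqDefect ι ^ n) (w s)) = _
        rw [neumannSum_sqDefect_pow]
        change N n (w s) - (C ^ n) (N n (w s)) = _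
        rw [hs]
      refine tendsto_integral_of_dominated_convergence (fun s ↦ 4 * (‖γ s‖ * ‖e s‖))
        (fun n ↦ ?_) (hle' (Integrable.const_mul hγe 4)) (fun n ↦ ?_) ?_
      · have h1 : AEStronglyMeasurable γ (volume.restrict (Ioo 0 T)) := hγ.1
        have h2 : ContinuousOn (fun s ↦ (N n * (1 - C ^ n)) (w s)) (Ioc 0 t) :=
          (N n * (1 - C ^ n)).continuous.comp_continuousOn
            (hwc.mono (hsub.trans Ioc_subset_Icc_self))
        rw [← restrict_Ioc_eq_restrict_Ioo] at h1
        exact (h1.mono_measure (Measure.restrict_mono hsub le_rfl)).inner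
          (h2.aestronglyMeasurable measurableSet_Ioc)
      · filter_upwards [hle heq] with s hs
        refine (norm_inner_le_norm _ _).trans ?_
        rw [hs n]
        have h1 := norm_sqDefect_pow_le hι n (e s)
        have h2 := norm_sqDefect_pow_le hι n (e s - (C ^ n) (e s))
        have h3 := norm_sub_le (e s) ((C ^ n) (e s))
        have h4 := norm_sub_le (e s - (C ^ n) (e s)) ((C ^ n) (e s - (C ^ n) (e s)))
        have h5 : ‖e s - (C ^ n) (e s) - (C ^ n) (e s - (C ^ n) (e s))‖ ≤ 4 * ‖e s‖ := by
          linarith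
        nlinarith [norm_nonneg (γ s)]
      -- Here `(1 - C ^ n)² e` tends to `e - P e`, and the term `⟨γ, P e⟩ = ⟨P γ, e⟩` vanishes.
      · filter_upwards [hle heq, hle hPa] with s hs hs'
        simp only [hs]
        have h1 := tendsto_sqDefect_pow hι (e s)
        have h2 : Tendsto (fun n : ℕ ↦ (C ^ (n + n)) (e s)) atTop (𝓝 (P (e s))) :=
          h1.comp (tendsto_atTop_mono (fun n ↦ Nat.le_add_left n n) tendsto_id)
        have h3 : Tendsto (fun n : ℕ ↦ e s - (C ^ n) (e s) - (C ^ n) (e s - (C ^ n) (e s))) atTop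
            (𝓝 (e s - P (e s) - (P (e s) - P (e s)))) := by
          refine ((tendsto_const_nhds.sub h1).sub (h1.sub h2)).congr fun n ↦ ?_
          rw [map_sub, sqDefect_pow_add_apply]
        have h4 := (tendsto_const_nhds (x := γ s)).inner h3 (𝕜 := ℝ)
        rw [sub_self, sub_zero, inner_sub_right, ← Submodule.inner_starProjection_left_eq_right,
          hs', inner_zero_left, sub_zero] at h4
        exact h4
    have h0 : (0 : ℝ) ∈ Icc 0 T := ⟨le_rfl, hT.le⟩
    refine tendsto_nhds_unique ((hE t ht).norm.pow 2) ?_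
    simp only [hid]
    exact ((hE 0 h0).norm.pow 2).add (hI.const_mul 2)

end EnergyIdentityMain

/-! ### Poincaré inequalities for smooth functions. -/

section Poincare

/-- This is nonnegativity of `∫ (g - c)²` with `c` the mean of `g`. -/
theorem sq_integral_le {α : Type*} [MeasurableSpace α] {μ : Measure α} [IsFiniteMeasure μ]
    {g : α → ℝ} (hg : Integrable g μ) (hg2 : Integrable (fun x ↦ g x ^ 2) μ) :
    (∫ x, g x ∂μ) ^ 2 ≤ μ.real univ * ∫ x, g x ^ 2 ∂μ := by
  rcases eq_or_ne μ 0 with rfl | hμ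
  · simp
  set m := μ.real univ with hm
  have hm0 : 0 < m := by
    rw [hm, measureReal_def]
    exact ENNReal.toReal_pos (by simpa using hμ) (measure_ne_top _ _)
  set c := (∫ x, g x ∂μ) / m with hc
  have h0 : 0 ≤ ∫ x, (g x - c) ^ 2 ∂μ := integral_nonneg fun x ↦ sq_nonneg _
  have h1 : ∫ x, (g x - c) ^ 2 ∂μ = ∫ x, g x ^ 2 ∂μ - 2 * c * ∫ x, g x ∂μ + m * c ^ 2 := by
    have : ∀ x, (g x - c) ^ 2 = g x ^ 2 - 2 * c * g x + c ^ 2 := fun x ↦ by ring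
    simp only [this]
    have hi : Integrable (fun x ↦ g x ^ 2 - 2 * c * g x) μ := hg2.sub (hg.const_mul _)
    rw [integral_add hi (integrable_const _), integral_sub hg2 (hg.const_mul _), integral_const_mul, integral_const, smul_eq_mul]
  have h2 : ∫ x, g x ∂μ = c * m := by rw [hc]; field_simp
  rw [h1, h2] at h0
  rw [h2]
  nlinarith

theorem norm_sq_eq_integral {α : Type*} [MeasurableSpace α] {μ : Measure α} {E : Type*}
    [NormedAddCommGroup E] [InnerProductSpace ℝ E] (g : Lp E 2 μ) :
    ‖g‖ ^ 2 = ∫ x, ‖g x‖ ^ 2 ∂μ := by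
  rw [← real_inner_self_eq_norm_sq, L2.inner_def]
  simp only [real_inner_self_eq_norm_sq]

variable {d : ℕ}

theorem gradient_continuous {φ : Space d → ℝ} (h : ContDiff ℝ ∞ φ) : Continuous (gradient φ) :=
  (InnerProductSpace.toDual ℝ (Space d)).symm.continuous.comp (h.continuous_fderiv (by simp))

theorem norm_gradient (φ : Space d → ℝ) (x : Space d) : ‖gradient φ x‖ = ‖fderiv ℝ φ x‖ :=
  LinearIsometryEquiv.norm_map _ _

section Periodic

variable (b : Module.Basis (Fin d) ℝ (Space d))

theorem periodic_span {X : Type*} {F : Space d → X} (hF : ∀ i x, F (x + b i) = F x)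
    {l : Space d} (hl : l ∈ Submodule.span ℤ (range b)) (x : Space d) : F (x + l) = F x := by
  induction hl using Submodule.span_induction generalizing x with
  | mem y hy => obtain ⟨i, rfl⟩ := hy; exact hF i x
  | zero => simp
  | add y z _ _ hy hz => rw [← add_assoc, hz, hy]
  | smul n y _ hy =>
    induction n using Int.induction_on generalizing x with
    | zero => simp
    | succ n ih => rw [add_smul, one_smul, ← add_assoc, hy, ih]
    | pred n ih => rw [← hy, sub_smul, one_smul, add_assoc, sub_add_cancel, ih]

theorem exists_bound_of_periodic {X : Type*} [NormedAddCommGroup X] {F : Space d → X}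
    (hF : ∀ i x, F (x + b i) = F x) (hc : Continuous F) : ∃ K, ∀ x, ‖F x‖ ≤ K := by
  have hb := ZSpan.fundamentalDomain_isBounded b
  obtain ⟨K, hK⟩ := hb.isCompact_closure.exists_bound_of_continuousOn hc.continuousOn
  refine ⟨K, fun x ↦ ?_⟩
  have h1 : F (ZSpan.fract b x) = F x := by
    have := periodic_span b hF (ZSpan.floor b x).2 (ZSpan.fract b x)
    rw [← this, ZSpan.fract_apply, sub_add_cancel]
  rw [← h1]
  exact hK _ (subset_closure (ZSpan.fract_mem_fundamentalDomain b x))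

/-- A translate of the cell is again a fundamental domain of the lattice, and an invariant function
has the same integral over all of them. -/
theorem setIntegral_translate {F : Space d → ℝ} (hF : ∀ i x, F (x + b i) = F x) (h : Space d) :
    ∫ x in ZSpan.fundamentalDomain b, F (h + x) = ∫ x in ZSpan.fundamentalDomain b, F x := by
  have hfd := ZSpan.isAddFundamentalDomain' b (volume : Measure (Space d))
  have : Countable (Submodule.span ℤ (range b)).toAddSubgroup :=
    inferInstanceAs (Countable (Submodule.span ℤ (range b)))
  have hfd2 := hfd.vadd_of_comm h
  rw [hfd.setIntegral_eq hfd2 (f := F) fun g x ↦ ?_]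
  · rw [← image_vadd]
    exact ((measurePreserving_add_left volume h).setIntegral_image_emb
      (measurableEmbedding_addLeft h) F _).symm
  · rw [AddSubgroup.vadd_def, vadd_eq_add, add_comm]
    exact periodic_span b hF g.2 x

theorem gradient_periodic {φ : Space d → ℝ} (hφ : ∀ i x, φ (x + b i) = φ x) (i : Fin d)
    (x : Space d) : gradient φ (x + b i) = gradient φ x := by
  simp only [gradient]
  congr 1
  rw [← fderiv_comp_add_right]
  simp only [hφ]

/-- The fundamental theorem of calculus along the segment from `y` to `y + h`, then Cauchy–Schwarz
in the parameter. -/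
theorem sq_sub_le_integral_gradient {φ : Space d → ℝ} (hs : ContDiff ℝ ∞ φ) (y h : Space d) :
    (φ (y + h) - φ y) ^ 2 ≤ ‖h‖ ^ 2 * ∫ s in Icc (0 : ℝ) 1, ‖gradient φ (s • h + y)‖ ^ 2 := by
  have hline : ∀ s : ℝ, HasDerivAt (fun s : ℝ ↦ s • h + y) h s := fun s ↦ by
    simpa using ((hasDerivAt_id s).smul_const h).add_const y
  have hd : ∀ s : ℝ, HasDerivAt (fun s : ℝ ↦ φ (s • h + y)) (fderiv ℝ φ (s • h + y) h) s :=
    fun s ↦ ((hs.differentiable (by simp) _).hasFDerivAt).comp_hasDerivAt s (hline s)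
  have hlc : Continuous fun s : ℝ ↦ s • h + y := by fun_prop
  have hdc : Continuous fun s : ℝ ↦ fderiv ℝ φ (s • h + y) h :=
    ((hs.continuous_fderiv (by simp)).comp hlc).clm_apply continuous_const
  have hgc : Continuous fun s : ℝ ↦ ‖gradient φ (s • h + y)‖ ^ 2 :=
    ((gradient_continuous hs).comp hlc).norm.pow 2
  have e1 := intervalIntegral.integral_eq_sub_of_hasDerivAt (fun s _ ↦ hd s)
    (hdc.intervalIntegrable 0 1)
  rw [intervalIntegral.integral_of_le zero_le_one, ← integral_Icc_eq_integral_Ioc] at e1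
  simp only [one_smul, zero_smul, zero_add] at e1
  rw [add_comm y h, ← e1]
  have h2 := sq_integral_le (μ := volume.restrict (Icc (0 : ℝ) 1))
    (hdc.continuousOn.integrableOn_compact isCompact_Icc)
    ((hdc.pow 2).continuousOn.integrableOn_compact isCompact_Icc)
  simp only [measureReal_restrict_apply_univ, Real.volume_real_Icc, sub_zero,
    zero_le_one, sup_of_le_left, one_mul] at h2
  refine h2.trans ?_
  rw [← integral_const_mul]
  refine integral_mono ((hdc.pow 2).continuousOn.integrableOn_compact isCompact_Icc)
    ((hgc.const_mul _).continuousOn.integrableOn_compact isCompact_Icc) fun s ↦ ?_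
  simp only
  rw [← mul_pow, norm_gradient, mul_comm]
  exact sq_le_sq' (by
    have := (abs_le.1 ((fderiv ℝ φ (s • h + y)).le_opNorm h)).1
    linarith) ((le_abs_self _).trans ((fderiv ℝ φ (s • h + y)).le_opNorm h))

/-- Poincaré's inequality for smooth periodic functions. -/
theorem poincare_periodic : ∃ K, 0 ≤ K ∧ ∀ φ : Space d → ℝ, ContDiff ℝ ∞ φ →
    (∀ i x, φ (x + b i) = φ x) →
    ∫ x in ZSpan.fundamentalDomain b, (φ x - (volume.real (ZSpan.fundamentalDomain b))⁻¹ *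
        ∫ y in ZSpan.fundamentalDomain b, φ y) ^ 2 ≤
      K * ∫ x in ZSpan.fundamentalDomain b, ‖gradient φ x‖ ^ 2 := by
  set Q := ZSpan.fundamentalDomain b with hQ
  have hQm : MeasurableSet Q := ZSpan.fundamentalDomain_measurableSet b
  have hQb : Bornology.IsBounded Q := ZSpan.fundamentalDomain_isBounded b
  have : IsFiniteMeasure (volume.restrict Q) := ⟨by simpa using hQb.measure_lt_top⟩
  have hm0 : 0 < volume.real Q :=
    ENNReal.toReal_pos (ZSpan.measure_fundamentalDomain_ne_zero b) hQb.measure_lt_top.ne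
  set m := volume.real Q with hm
  -- After translation the displacement `h` runs over the cell itself, so a bound for its norm is
  -- the only length needed.
  obtain ⟨r, hr⟩ := hQb.exists_norm_le
  refine ⟨r ^ 2, sq_nonneg _, fun φ hs hp ↦ ?_⟩
  have hgp := gradient_periodic b hp
  have hgc := gradient_continuous hs
  obtain ⟨M, hM⟩ := exists_bound_of_periodic b hp hs.continuous
  obtain ⟨G, hG⟩ := exists_bound_of_periodic b hgp hgc
  have hφi : Integrable φ (volume.restrict Q) :=
    Integrable.of_bound hs.continuous.aestronglyMeasurable M (Eventually.of_forall hM)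
  have hg2i : Integrable (fun x ↦ ‖gradient φ x‖ ^ 2) (volume.restrict Q) :=
    Integrable.of_bound (hgc.norm.pow 2).aestronglyMeasurable (G ^ 2)
      (Eventually.of_forall fun x ↦ by
        rw [norm_pow, norm_norm]
        gcongr
        exact hG x)
  have hdb : ∀ x y, ‖(φ x - φ y) ^ 2‖ ≤ (M + M) ^ 2 := fun x y ↦ by
    rw [norm_pow]
    gcongr
    exact (norm_sub_le _ _).trans (add_le_add (hM x) (hM y))
  -- the mean is compared with the values
  have h1 : ∀ x, (φ x - m⁻¹ * ∫ y in Q, φ y) ^ 2 ≤ m⁻¹ * ∫ y in Q, (φ x - φ y) ^ 2 := by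
    intro x
    have hi : Integrable (fun y ↦ φ x - φ y) (volume.restrict Q) := (integrable_const _).sub hφi
    have hi2 : Integrable (fun y ↦ (φ x - φ y) ^ 2) (volume.restrict Q) :=
      Integrable.of_bound ((continuous_const.sub hs.continuous).pow 2).aestronglyMeasurable _
        (Eventually.of_forall (hdb x))
    have := sq_integral_le hi hi2
    rw [integral_sub (integrable_const _) hφi, integral_const, smul_eq_mul,
      measureReal_restrict_apply_univ, ← hm] at this
    have e : φ x - m⁻¹ * ∫ y in Q, φ y = m⁻¹ * (m * φ x - ∫ y in Q, φ y) := by field_simp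
    rw [e, mul_pow]
    calc (m⁻¹) ^ 2 * (m * φ x - ∫ y in Q, φ y) ^ 2
        ≤ (m⁻¹) ^ 2 * (m * ∫ y in Q, (φ x - φ y) ^ 2) := by gcongr
      _ = m⁻¹ * ∫ y in Q, (φ x - φ y) ^ 2 := by field_simp
  -- translation
  have h2 : ∀ x, ∫ y in Q, (φ x - φ y) ^ 2 = ∫ h in Q, (φ (x + h) - φ x) ^ 2 := by
    intro x
    rw [← setIntegral_translate b (F := fun y ↦ (φ x - φ y) ^ 2) (fun i y ↦ by simp [hp]) x]
    refine integral_congr_ae (Eventually.of_forall fun y ↦ ?_)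
    simp only
    ring
  -- With the integrals exchanged, translation by `s • h` disappears for each fixed `s`.
  have h3 : ∀ h ∈ Q, ∫ x in Q, (φ (x + h) - φ x) ^ 2 ≤ r ^ 2 * ∫ x in Q, ‖gradient φ x‖ ^ 2 := by
    intro h hh
    have hprod : Integrable (Function.uncurry fun (x : Space d) (s : ℝ) ↦
        ‖gradient φ (s • h + x)‖ ^ 2)
        ((volume.restrict Q).prod (volume.restrict (Icc (0 : ℝ) 1))) := by
      refine Integrable.of_bound (Continuous.aestronglyMeasurable ?_) (G ^ 2)
        (Eventually.of_forall fun x ↦ ?_)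
      · exact (hgc.comp (by fun_prop : Continuous fun p : Space d × ℝ ↦ p.2 • h + p.1)).norm.pow 2
      · rw [Function.uncurry, norm_pow, norm_norm]
        gcongr
        exact hG _
    calc ∫ x in Q, (φ (x + h) - φ x) ^ 2
        ≤ ∫ x in Q, ‖h‖ ^ 2 * ∫ s in Icc (0 : ℝ) 1, ‖gradient φ (s • h + x)‖ ^ 2 := by
          refine integral_mono ?_ (hprod.integral_prod_left.const_mul _) fun x ↦
            sq_sub_le_integral_gradient hs x h
          refine Integrable.of_bound (Continuous.aestronglyMeasurable ?_) _
            (Eventually.of_forall fun x ↦ hdb (x + h) x)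
          exact ((hs.continuous.comp (continuous_add_const h)).sub hs.continuous).pow 2
      _ = ‖h‖ ^ 2 * ∫ s in Icc (0 : ℝ) 1, ∫ x in Q, ‖gradient φ (s • h + x)‖ ^ 2 := by
          rw [integral_const_mul, integral_integral_swap hprod]
      _ = ‖h‖ ^ 2 * ∫ x in Q, ‖gradient φ x‖ ^ 2 := by
          congr 1
          have : ∀ s : ℝ, ∫ x in Q, ‖gradient φ (s • h + x)‖ ^ 2 =
              ∫ x in Q, ‖gradient φ x‖ ^ 2 := fun s ↦
            setIntegral_translate b (F := fun x ↦ ‖gradient φ x‖ ^ 2)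
              (fun i x ↦ by simp [hgp]) (s • h)
          simp [this]
      _ ≤ r ^ 2 * ∫ x in Q, ‖gradient φ x‖ ^ 2 := by
          gcongr
          exact hr h hh
  have hprod : Integrable (Function.uncurry fun (x h : Space d) ↦ (φ (x + h) - φ x) ^ 2)
      ((volume.restrict Q).prod (volume.restrict Q)) := by
    refine Integrable.of_bound (Continuous.aestronglyMeasurable ?_) _
      (Eventually.of_forall fun p ↦ hdb (p.1 + p.2) p.1)
    exact ((hs.continuous.comp continuous_add).sub (hs.continuous.comp continuous_fst)).pow 2
  calc ∫ x in Q, (φ x - m⁻¹ * ∫ y in Q, φ y) ^ 2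
      ≤ ∫ x in Q, m⁻¹ * ∫ h in Q, (φ (x + h) - φ x) ^ 2 := by
        refine integral_mono ?_ (hprod.integral_prod_left.const_mul _) fun x ↦ ?_
        · refine Integrable.of_bound ((hs.continuous.sub continuous_const).pow
            2).aestronglyMeasurable ((M + ‖m⁻¹ * ∫ y in Q, φ y‖) ^ 2)
            (Eventually.of_forall fun x ↦ ?_)
          rw [norm_pow]
          gcongr
          exact (norm_sub_le _ _).trans (by gcongr; exact hM x)
        · exact (h1 x).trans_eq (by rw [h2])
    _ = m⁻¹ * ∫ h in Q, ∫ x in Q, (φ (x + h) - φ x) ^ 2 := by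
        rw [integral_const_mul, integral_integral_swap hprod]
    _ ≤ m⁻¹ * ∫ h in Q, r ^ 2 * ∫ x in Q, ‖gradient φ x‖ ^ 2 := by
        refine mul_le_mul_of_nonneg_left ?_ (inv_nonneg.2 hm0.le)
        exact setIntegral_mono_on (f := fun h ↦ ∫ x in Q, (φ (x + h) - φ x) ^ 2)
          hprod.integral_prod_right (integrable_const _) hQm h3
    _ = r ^ 2 * ∫ x in Q, ‖gradient φ x‖ ^ 2 := by
        rw [integral_const, smul_eq_mul, measureReal_restrict_apply_univ, ← hm]
        field_simp

end Periodic

end Poincare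

variable {d : ℕ}

/-- Poincaré's inequality for test functions on a bounded set. -/
theorem poincare_dirichlet (hd : 1 ≤ d) {Ω : Set (Space d)} (hb : Bornology.IsBounded Ω) :
    ∃ K, 0 ≤ K ∧ ∀ φ : Space d → ℝ, ContDiff ℝ ∞ φ → HasCompactSupport φ → tsupport φ ⊆ Ω →
      ∫ x in Ω, φ x ^ 2 ≤ K * ∫ x in Ω, ‖gradient φ x‖ ^ 2 := by
  obtain ⟨r, hr⟩ := hb.exists_norm_le
  refine ⟨4 * r ^ 2, by positivity, fun φ hs hc hsub ↦ ?_⟩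
  have hz : ∀ x, x ∉ Ω → φ x = 0 := fun x hx ↦
    image_eq_zero_of_notMem_tsupport fun h ↦ hx (hsub h)
  have hfc : HasCompactSupport (fderiv ℝ φ) := hc.fderiv (𝕜 := ℝ)
  have hz' : ∀ x, x ∉ Ω → fderiv ℝ φ x = 0 := fun x hx ↦
    image_eq_zero_of_notMem_tsupport fun h ↦ hx (hsub (tsupport_fderiv_subset ℝ h))
  rw [setIntegral_eq_integral_of_forall_compl_eq_zero fun x hx ↦ by simp [hz x hx],
    setIntegral_eq_integral_of_forall_compl_eq_zero fun x hx ↦ by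
      simp [norm_gradient, hz' x hx]]
  simp only [norm_gradient]
  -- A unit coordinate vector and its coordinate: since `π` has derivative one along `e`,
  -- integrating `φ²` against it by parts produces `-∫ 2 φ (∂ₑφ) π`.
  obtain ⟨e, π, he, hπ1, hπ⟩ : ∃ (e : Space d) (π : Space d →L[ℝ] ℝ),
      ‖e‖ = 1 ∧ π e = 1 ∧ ∀ x, |π x| ≤ ‖x‖ :=
    ⟨EuclideanSpace.single ⟨0, hd⟩ 1, EuclideanSpace.proj ⟨0, hd⟩, by simp, by simp,
      fun x ↦ PiLp.norm_apply_le x ⟨0, hd⟩⟩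
  have hfd : Continuous (fderiv ℝ φ) := hs.continuous_fderiv (by simp)
  have hφc := hs.continuous
  have hde : ∀ x, fderiv ℝ (fun y ↦ φ y ^ 2) x e = 2 * φ x * fderiv ℝ φ x e := fun x ↦ by
    have := ((hs.differentiable (by simp) x).hasFDerivAt.pow 2).fderiv
    rw [this]
    simp
  have hpe : ∀ x, fderiv ℝ π x e = 1 := fun x ↦ by
    rw [π.fderiv, hπ1]
  have hc2 : HasCompactSupport fun x ↦ φ x ^ 2 := hc.mono fun x hx h0 ↦ hx (by simp [h0])
  have hfc2 : HasCompactSupport fun x ↦ ‖fderiv ℝ φ x‖ ^ 2 :=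
    hfc.mono fun x hx h0 ↦ hx (by simp [h0])
  have hi1 : Integrable fun x ↦ φ x ^ 2 := (hφc.pow 2).integrable_of_hasCompactSupport hc2
  have hi2 : Integrable fun x ↦ ‖fderiv ℝ φ x‖ ^ 2 :=
    (hfd.norm.pow 2).integrable_of_hasCompactSupport hfc2
  have hi3 : Integrable fun x ↦ 2 * φ x * fderiv ℝ φ x e * π x := by
    refine Continuous.integrable_of_hasCompactSupport
      (((continuous_const.mul hφc).mul (hfd.clm_apply continuous_const)).mul π.continuous) ?_
    exact (hc.mul_left (f := fun _ ↦ (2 : ℝ))).mul_right.mul_right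
  have hi4 : Integrable fun x ↦ φ x ^ 2 * π x := by
    refine Continuous.integrable_of_hasCompactSupport ((hφc.pow 2).mul π.continuous) ?_
    exact hc2.mul_right
  have key := integral_mul_fderiv_eq_neg_fderiv_mul_of_integrable (μ := (volume : Measure (Space d)))
    (f := fun x ↦ φ x ^ 2) (g := π) (v := e) (by simpa only [hde] using hi3)
    (by simpa only [hpe, mul_one] using hi1) hi4
    (fun x _ ↦ (hs.differentiable (by simp) x).pow 2)
    (fun x _ ↦ π.differentiableAt)
  simp only [hde, hpe, mul_one] at key
  -- The weight `1 / 2` lets the `φ²` term be absorbed on the left, which doubles `2 r²` to the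
  -- constant `4 r²`.
  have hpt : ∀ x, -(2 * φ x * fderiv ℝ φ x e * π x) ≤
      1 / 2 * φ x ^ 2 + 2 * r ^ 2 * ‖fderiv ℝ φ x‖ ^ 2 := by
    intro x
    by_cases hx : x ∈ Ω
    · have h1 : |π x| ≤ r := (hπ x).trans (hr x hx)
      have h2 : |fderiv ℝ φ x e| ≤ ‖fderiv ℝ φ x‖ := by
        refine ((fderiv ℝ φ x).le_opNorm e).trans_eq ?_
        rw [he, mul_one]
      have h3 : |fderiv ℝ φ x e * π x| ≤ ‖fderiv ℝ φ x‖ * r := by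
        rw [abs_mul]
        gcongr
      have h4 : (fderiv ℝ φ x e * π x) ^ 2 ≤ (‖fderiv ℝ φ x‖ * r) ^ 2 :=
        sq_le_sq' (abs_le.1 h3).1 (abs_le.1 h3).2
      nlinarith [sq_nonneg (φ x + 2 * (fderiv ℝ φ x e * π x))]
    · rw [hz x hx]
      simp only [mul_zero, zero_mul, neg_zero]
      positivity
  have h5 : ∫ x, φ x ^ 2 ≤ 1 / 2 * (∫ x, φ x ^ 2) + 2 * r ^ 2 * ∫ x, ‖fderiv ℝ φ x‖ ^ 2 := by
    calc ∫ x, φ x ^ 2 = ∫ x, -(2 * φ x * fderiv ℝ φ x e * π x) := by rw [integral_neg, key]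
      _ ≤ ∫ x, (1 / 2 * φ x ^ 2 + 2 * r ^ 2 * ‖fderiv ℝ φ x‖ ^ 2) :=
          integral_mono hi3.neg ((hi1.const_mul _).add (hi2.const_mul _)) hpt
      _ = _ := by
          rw [integral_add (hi1.const_mul _) (hi2.const_mul _), integral_const_mul,
            integral_const_mul]
  linarith

/-! ### Existence and positivity of the Poincaré constant. -/

namespace BoundaryCondition

variable {d : ℕ} {B : BoundaryCondition d}

theorem IsTest.sub_const {b : Module.Basis (Fin d) ℝ (Space d)} {φ : Space d → ℝ}
    (h : (periodic b).IsTest φ) (c : ℝ) : (periodic b).IsTest fun x ↦ φ x - c :=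
  ⟨h.1.sub contDiff_const, fun i x ↦ by simp only [h.2 i x]⟩

theorem IsTest.exists_bound {φ : Space d → ℝ} (h : B.IsTest φ) :
    ∃ M, ∀ x, ‖φ x‖ ≤ M ∧ ‖gradient φ x‖ ≤ M := by
  have key : (∃ K, ∀ x, ‖φ x‖ ≤ K) ∧ ∃ K, ∀ x, ‖gradient φ x‖ ≤ K := by
    cases B with
    | dirichlet Ω _ _ _ =>
      refine ⟨h.2.1.exists_bound_of_continuous h.1.continuous, ?_⟩
      obtain ⟨K, hK⟩ := (h.2.1.fderiv (𝕜 := ℝ)).exists_bound_of_continuous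
        (h.1.continuous_fderiv (by simp))
      exact ⟨K, fun x ↦ (norm_gradient φ x).le.trans (hK x)⟩
    | periodic b =>
      exact ⟨exists_bound_of_periodic b h.2 h.1.continuous,
        exists_bound_of_periodic b (gradient_periodic b h.2) (gradient_continuous h.1)⟩
  obtain ⟨⟨K, hK⟩, ⟨L, hL⟩⟩ := key
  exact ⟨max K L, fun x ↦ ⟨(hK x).trans (le_max_left _ _), (hL x).trans (le_max_right _ _)⟩⟩

/-- Every test function defines an element of the space of smooth pairs. -/
theorem IsTest.exists_pair {φ : Space d → ℝ} (h : B.IsTest φ) :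
    ∃ p ∈ B.smoothPairs, p.fst =ᵐ[B.measure] φ ∧ p.snd =ᵐ[B.measure] gradient φ := by
  obtain ⟨M, hM⟩ := h.exists_bound
  have h1 : MemLp φ 2 B.measure := MemLp.of_bound h.contDiff.continuous.aestronglyMeasurable M
    (Eventually.of_forall fun x ↦ (hM x).1)
  have h2 : MemLp (gradient φ) 2 B.measure :=
    MemLp.of_bound (gradient_continuous h.contDiff).aestronglyMeasurable M
      (Eventually.of_forall fun x ↦ (hM x).2)
  exact ⟨WithLp.toLp 2 (h1.toLp, h2.toLp), ⟨φ, h, h1.coeFn_toLp, h2.coeFn_toLp⟩,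
    h1.coeFn_toLp, h2.coeFn_toLp⟩

theorem measure_ne_zero (B : BoundaryCondition d) : B.measure ≠ 0 := by
  rw [measure, Ne, Measure.restrict_eq_zero]
  cases B with
  | dirichlet Ω ho hb hn => exact (ho.measure_pos volume hn).ne'
  | periodic b => exact ZSpan.measure_fundamentalDomain_ne_zero b

theorem measureReal_pos (B : BoundaryCondition d) : 0 < B.measure.real univ :=
  ENNReal.toReal_pos (by simpa using B.measure_ne_zero) (measure_ne_top _ _)

/-- The first component of a pair, as a continuous linear map. -/
def fstL (B : BoundaryCondition d) : L2Pair B.measure →L[ℝ] Lp ℝ 2 B.measure :=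
  WithLp.fstL 2 ℝ _ _

/-- The second component of a pair, as a continuous linear map. -/
def sndL (B : BoundaryCondition d) : L2Pair B.measure →L[ℝ] Lp (Space d) 2 B.measure :=
  WithLp.sndL 2 ℝ _ _

/-- The functional that has to be subtracted for Poincaré's inequality to hold: zero for Dirichlet
conditions, the mean for periodic conditions. -/
def offset : (B : BoundaryCondition d) → Lp ℝ 2 B.measure →L[ℝ] ℝ
  | dirichlet _ _ _ _ => 0
  | periodic b => (volume.real (ZSpan.fundamentalDomain b))⁻¹ •
      innerSL ℝ (Lp.const 2 (periodic b).measure (1 : ℝ))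

theorem offset_periodic (b : Module.Basis (Fin d) ℝ (Space d))
    (g : Lp ℝ 2 (periodic b).measure) :
    (periodic b).offset g = (volume.real (ZSpan.fundamentalDomain b))⁻¹ *
      ∫ x, g x ∂(periodic b).measure := by
  simp only [offset, smul_apply, innerSL_apply_apply, L2.inner_def, smul_eq_mul]
  congr 1
  refine integral_congr_ae ?_
  filter_upwards [Lp.coeFn_const (p := 2) (μ := (periodic b).measure) (1 : ℝ)] with x hx
  rw [hx]
  simp

theorem energySpace_le (B : BoundaryCondition d) :
    B.energySpace ≤ B.smoothPairs.topologicalClosure := by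
  cases B with
  | dirichlet Ω _ _ _ => exact le_rfl
  | periodic b => exact inf_le_left

/-- Treats both settings at once: the energy space is the kernel of `offset` in the closure of the
smooth pairs. -/
theorem mem_energySpace_iff {p : L2Pair B.measure} :
    p ∈ B.energySpace ↔ p ∈ B.smoothPairs.topologicalClosure ∧ B.offset p.fst = 0 := by
  cases B with
  | dirichlet Ω _ _ _ => exact ⟨fun h ↦ ⟨h, rfl⟩, fun h ↦ h.1⟩
  | periodic b =>
    rw [offset_periodic]
    refine and_congr_right fun _ ↦ ?_
    have := (periodic b).measureReal_pos
    rw [measure, measureReal_restrict_apply_univ] at this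
    have h0 : (volume.real (ZSpan.fundamentalDomain b))⁻¹ ≠ 0 := (inv_pos.2 this).ne'
    rw [mul_eq_zero, or_iff_right h0]
    rfl

theorem offset_toL2 (v : B.energySpace) : B.offset (B.toL2 v) = 0 :=
  (mem_energySpace_iff.1 v.2).2

/-- Poincaré's inequality on the closure of the smooth pairs. -/
theorem exists_poincare (hd : 1 ≤ d) (B : BoundaryCondition d) :
    ∃ K, 0 ≤ K ∧ ∀ p ∈ B.smoothPairs.topologicalClosure,
      ‖p.fst - Lp.const 2 B.measure (B.offset p.fst)‖ ≤ K * ‖p.snd‖ := by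
  obtain ⟨K, hK0, hK⟩ : ∃ K, 0 ≤ K ∧ ∀ p ∈ B.smoothPairs,
      ‖p.fst - Lp.const 2 B.measure (B.offset p.fst)‖ ^ 2 ≤ K * ‖p.snd‖ ^ 2 := by
    have hnorm : ∀ (p : L2Pair B.measure) (φ : Space d → ℝ) (c : ℝ), p.fst =ᵐ[B.measure] φ →
        ‖p.fst - Lp.const 2 B.measure c‖ ^ 2 = ∫ x, (φ x - c) ^ 2 ∂B.measure := by
      intro p φ c h
      rw [norm_sq_eq_integral]
      refine integral_congr_ae ?_
      filter_upwards [h, Lp.coeFn_sub p.fst (Lp.const 2 B.measure c),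
        Lp.coeFn_const (p := 2) (μ := B.measure) c] with x h1 h2 h3
      rw [h2, Pi.sub_apply, h1, h3, Real.norm_eq_abs, sq_abs]
      rfl
    have hnorm' : ∀ (p : L2Pair B.measure) (φ : Space d → ℝ), p.snd =ᵐ[B.measure] gradient φ →
        ‖p.snd‖ ^ 2 = ∫ x, ‖gradient φ x‖ ^ 2 ∂B.measure := by
      intro p φ h
      rw [norm_sq_eq_integral]
      exact integral_congr_ae (h.mono fun x hx ↦ by simp only [hx])
    cases B with
    | dirichlet Ω ho hb hn =>
      obtain ⟨K, hK0, hK⟩ := poincare_dirichlet hd hb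
      refine ⟨K, hK0, ?_⟩
      rintro p ⟨φ, h, h1, h2⟩
      rw [hnorm p φ _ h1, hnorm' p φ h2]
      have h0 : (dirichlet Ω ho hb hn).offset p.fst = 0 := rfl
      rw [h0]
      simpa [measure, domain] using hK φ h.1 h.2.1 h.2.2
    | periodic b =>
      obtain ⟨K, hK0, hK⟩ := poincare_periodic b
      refine ⟨K, hK0, ?_⟩
      rintro p ⟨φ, h, h1, h2⟩
      rw [hnorm p φ _ h1, hnorm' p φ h2, offset_periodic, integral_congr_ae h1]
      exact hK φ h.1 h.2
  -- The estimate on smooth pairs is for squares, whence the root; the inequality is a closed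
  -- condition on pairs.
  refine ⟨√K, Real.sqrt_nonneg _, fun p hp ↦ ?_⟩
  have hclosed : IsClosed {p : L2Pair B.measure |
      ‖p.fst - Lp.const 2 B.measure (B.offset p.fst)‖ ≤ √K * ‖p.snd‖} := by
    refine isClosed_le ?_ ?_
    · exact (B.fstL.continuous.sub ((Lp.constL 2 B.measure ℝ).continuous.comp
        (B.offset.continuous.comp B.fstL.continuous))).norm
    · exact continuous_const.mul B.sndL.continuous.norm
  rw [← SetLike.mem_coe, Submodule.topologicalClosure_coe] at hp
  refine closure_minimal (fun q hq ↦ ?_) hclosed hp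
  have := hK q hq
  rw [mem_ofPred_eq, ← pow_le_pow_iff_left₀ (norm_nonneg _) (by positivity) two_ne_zero, mul_pow,
    Real.sq_sqrt hK0]
  exact this

/-- Nontriviality of the space is what makes the Poincaré constant positive: a bump function, or a
cosine minus its mean. -/
theorem exists_toL2_ne_zero (hd : 1 ≤ d) (B : BoundaryCondition d) :
    ∃ v : B.energySpace, B.toL2 v ≠ 0 := by
  have key : ∀ φ : Space d → ℝ, B.IsTest φ → ∀ p ∈ B.smoothPairs, p.fst =ᵐ[B.measure] φ →
      B.offset p.fst = 0 → (∃ x ∈ interior B.domain, φ x ≠ 0) →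
      ∃ v : B.energySpace, B.toL2 v ≠ 0 := by
    rintro φ hφ p hp h1 h2 ⟨x, hx, hx0⟩
    refine ⟨⟨p, mem_energySpace_iff.2 ⟨subset_closure hp, h2⟩⟩, fun h0 ↦ ?_⟩
    change p.fst = 0 at h0
    rw [h0] at h1
    have h3 : ∀ᵐ y ∂B.measure, φ y = 0 := by
      filter_upwards [h1, Lp.coeFn_zero ℝ 2 B.measure] with y hy hy'
      rw [← hy, hy']
      rfl
    have ho : IsOpen (interior B.domain ∩ {y | φ y ≠ 0}) :=
      isOpen_interior.inter (isOpen_ne_fun hφ.contDiff.continuous continuous_const)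
    have h4 := ho.measure_pos volume ⟨x, hx, hx0⟩
    have h5 : B.measure {y | ¬ φ y = 0} = 0 := h3
    refine absurd (le_antisymm ?_ (zero_le)) h4.ne'
    rw [← h5, measure]
    refine le_trans ?_ (Measure.le_restrict_apply _ _)
    exact measure_mono fun y hy ↦ ⟨hy.2, interior_subset hy.1⟩
  cases B with
  | dirichlet Ω ho hb hn =>
    have ⟨x, hx⟩ := hn
    obtain ⟨φ, h1, h2, h3, -, h4⟩ := exists_contDiff_tsupport_subset (n := ⊤) (ho.mem_nhds hx)
    have ht : (dirichlet Ω ho hb hn).IsTest φ := ⟨h3, h2, h1⟩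
    obtain ⟨p, hp, hp1, -⟩ := ht.exists_pair
    exact key φ ht p hp hp1 rfl ⟨x, by simpa [domain, ho.interior_eq] using hx, by simp [h4]⟩
  | periodic b =>
    let i : Fin d := ⟨0, hd⟩
    have hlin : ∀ j, Continuous fun x ↦ b.repr x j := fun j ↦
      LinearMap.continuous_of_finiteDimensional (b.coord j)
    have hc : ContDiff ℝ ∞ fun x ↦ b.repr x i :=
      (LinearMap.toContinuousLinearMap (b.coord i)).contDiff
    have hφ : (periodic b).IsTest fun x ↦ Real.cos (2 * Real.pi * b.repr x i) := by
      refine ⟨Real.contDiff_cos.comp (contDiff_const.mul hc), fun j x ↦ ?_⟩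
      simp only [map_add, Finsupp.add_apply]
      rw [b.repr_self, Finsupp.single_apply]
      split_ifs
      · rw [mul_add, mul_one, Real.cos_add_two_pi]
      · rw [add_zero]
    obtain ⟨q, hq, hq1, -⟩ := hφ.exists_pair
    set c := (periodic b).offset q.fst with hc'
    have ht := hφ.sub_const c
    obtain ⟨p, hp, hp1, -⟩ := ht.exists_pair
    refine key _ ht p hp hp1 ?_ ?_
    · have hm := (periodic b).measureReal_pos
      have hi : Integrable (fun x ↦ Real.cos (2 * Real.pi * b.repr x i))
          (periodic b).measure :=
        (((Lp.memLp q.fst).integrable (by norm_num)).congr hq1)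
      rw [offset_periodic, integral_congr_ae hq1] at hc'
      rw [offset_periodic, integral_congr_ae hp1, integral_sub hi (integrable_const _),
        integral_const, mul_sub, ← hc']
      rw [measure, measureReal_restrict_apply_univ] at hm ⊢
      change _ - (volume.real (ZSpan.fundamentalDomain b))⁻¹ *
        (volume.real (ZSpan.fundamentalDomain b) * c) = 0
      have hm' : volume.real (ZSpan.fundamentalDomain b) ≠ 0 := hm.ne'
      field_simp
      ring
    · have hint : {x : Space d | ∀ j, b.repr x j ∈ Ioo (0 : ℝ) 1} ⊆
          interior (periodic b).domain := by
        refine interior_maximal (fun x hx ↦ ?_) ?_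
        · exact (ZSpan.mem_fundamentalDomain b).2 fun j ↦ Ioo_subset_Ico_self (hx j)
        · simp only [ofPred_forall]
          exact isOpen_iInter_of_finite fun j ↦ isOpen_Ioo.preimage (hlin j)
      have hrep : ∀ (s : ℝ) j, b.repr (∑ k, s • b k) j = s := fun s j ↦ by
        simp [b.repr_self, Finsupp.single_apply]
      -- The cosine takes the values `-1` and `0` at coordinates `1/2` and `1/4`, so at one of these
      -- interior points it differs from its mean.
      by_cases h : Real.cos (2 * Real.pi * (1 / 2)) = c
      · refine ⟨∑ k, (1 / 4 : ℝ) • b k, hint fun j ↦ ?_, ?_⟩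
        · rw [hrep]; constructor <;> norm_num
        · rw [hrep, ← h, show 2 * Real.pi * (1 / 4) = Real.pi / 2 by ring,
            show 2 * Real.pi * (1 / 2) = Real.pi by ring]
          simp
      · refine ⟨∑ k, (1 / 2 : ℝ) • b k, hint fun j ↦ ?_, ?_⟩
        · rw [hrep]; constructor <;> norm_num
        · rw [hrep]
          exact sub_ne_zero.2 h

/-- The Poincaré constant exists and is positive. -/
theorem exists_isPoincareConstant (hd : 1 ≤ d) (B : BoundaryCondition d) :
    ∃ C, 0 < C ∧ B.IsPoincareConstant C := by
  obtain ⟨K, hK0, hK⟩ := B.exists_poincare hd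
  set S := {C : ℝ | ∀ v : B.energySpace, ‖B.toL2 v‖ ≤ C * ‖B.grad v‖} with hS
  have hKS : K ∈ S := fun v ↦ by
    have := hK v (B.energySpace_le v.2)
    change ‖B.toL2 v - Lp.const 2 B.measure (B.offset (B.toL2 v))‖ ≤ K * ‖B.grad v‖ at this
    rwa [offset_toL2, map_zero, sub_zero] at this
  obtain ⟨v, hv⟩ := B.exists_toL2_ne_zero hd
  have hv0 : 0 < ‖B.toL2 v‖ := norm_pos_iff.2 hv
  have hg0 : 0 < ‖B.grad v‖ := by
    rcases (norm_nonneg (B.grad v)).eq_or_lt with h | h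
    · have := hKS v
      rw [← h, mul_zero] at this
      linarith
    · exact h
  -- One nonzero element bounds every admissible constant from below by a positive quotient.
  have hpos : ∀ C ∈ S, ‖B.toL2 v‖ / ‖B.grad v‖ ≤ C := fun C hC ↦ (div_le_iff₀ hg0).2 (hC v)
  have hbdd : BddBelow S := ⟨_, hpos⟩
  have hclosed : IsClosed S := by
    simp only [hS, ofPred_forall]
    exact isClosed_iInter fun w ↦ isClosed_le continuous_const (continuous_mul_const _)
  have hmem := hclosed.csInf_mem ⟨K, hKS⟩ hbdd
  exact ⟨sInf S, (div_pos hv0 hg0).trans_le (hpos _ hmem), hmem, fun C hC ↦ csInf_le hbdd hC⟩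

end BoundaryCondition

/-! ### A smooth step function. -/

section Step

/-- A smooth function that vanishes on `(-∞, α]` and equals one on `[β, ∞)`. -/
def smoothStep (α β : ℝ) (s : ℝ) : ℝ := Real.smoothTransition ((s - α) / (β - α))

variable {α β : ℝ}

theorem contDiff_smoothStep : ContDiff ℝ ∞ (smoothStep α β) :=
  Real.smoothTransition.contDiff.comp ((contDiff_id.sub contDiff_const).div_const _)

theorem smoothStep_eq_zero_iff (h : α < β) {s : ℝ} : smoothStep α β s = 0 ↔ s ≤ α := by
  rw [smoothStep, Real.smoothTransition.zero_iff_nonpos, div_le_iff₀ (sub_pos.2 h), zero_mul,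
    sub_nonpos]

theorem smoothStep_eq_one_iff (h : α < β) {s : ℝ} : smoothStep α β s = 1 ↔ β ≤ s := by
  rw [smoothStep, Real.smoothTransition.eq_one_iff_one_le, le_div_iff₀ (sub_pos.2 h), one_mul,
    sub_le_sub_iff_right]

/-- Off the open interval the step attains its minimum or maximum. The endpoints are included
because an open gap still permits these values. -/
theorem deriv_smoothStep_eq_zero (h : α < β) {s : ℝ} (hs : s ∉ Ioo α β) :
    deriv (smoothStep α β) s = 0 := by
  rw [mem_Ioo, not_and_or, not_lt, not_lt] at hs
  rcases hs with hs | hs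
  · refine IsLocalMin.deriv_eq_zero (Eventually.of_forall fun r ↦ ?_)
    rw [(smoothStep_eq_zero_iff h).2 hs]
    exact Real.smoothTransition.nonneg _
  · refine IsLocalMax.deriv_eq_zero (Eventually.of_forall fun r ↦ ?_)
    rw [(smoothStep_eq_one_iff h).2 hs]
    exact Real.smoothTransition.le_one _

theorem exists_deriv_smoothStep_le (h : α < β) :
    ∃ C : NNReal, ∀ s, ‖deriv (smoothStep α β) s‖₊ ≤ C := by
  have hc : Continuous (deriv (smoothStep α β)) := contDiff_smoothStep.continuous_deriv (by simp)
  obtain ⟨C, hC⟩ := isCompact_Icc.exists_bound_of_continuousOn (hc.continuousOn (s := Icc α β))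
  refine ⟨C.toNNReal, fun s ↦ ?_⟩
  by_cases hs : s ∈ Ioo α β
  · rw [← NNReal.coe_le_coe, coe_nnnorm]
    exact (hC s (Ioo_subset_Icc_self hs)).trans (Real.le_coe_toNNReal C)
  · simp [deriv_smoothStep_eq_zero h hs]

end Step

/-! ### Functions of the energy space do not jump across a gap. -/

namespace BoundaryCondition

variable {d : ℕ} {B : BoundaryCondition d}

theorem IsTest.comp {φ : Space d → ℝ} (h : B.IsTest φ) {ψ : ℝ → ℝ} (hψ : ContDiff ℝ ∞ ψ)
    (h0 : ψ 0 = 0) : B.IsTest (ψ ∘ φ) := by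
  cases B with
  | dirichlet Ω _ _ _ =>
    exact ⟨hψ.comp h.1, h.2.1.comp_left h0, (tsupport_comp_subset h0 φ).trans h.2.2⟩
  | periodic b => exact ⟨hψ.comp h.1, fun i x ↦ by simp only [Function.comp_apply, h.2 i x]⟩

theorem gradient_comp {φ : Space d → ℝ} {ψ : ℝ → ℝ} {x : Space d}
    (hψ : DifferentiableAt ℝ ψ (φ x)) (hφ : DifferentiableAt ℝ φ x) :
    gradient (ψ ∘ φ) x = deriv ψ (φ x) • gradient φ x := by
  simp only [gradient]
  rw [(hψ.hasDerivAt.comp_hasFDerivAt x hφ.hasFDerivAt).fderiv, map_smul]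

/-- A function in the energy space that omits an interval is locally constant across it. -/
theorem exists_smoothStep_ae_eq (hd : 1 ≤ d) {α β : ℝ} (hαβ : α < β) {p : L2Pair B.measure}
    (hp : p ∈ B.smoothPairs.topologicalClosure)
    (hgap : ∀ᵐ x ∂B.measure, p.fst x ∉ Ioo α β) :
    ∃ g : Lp ℝ 2 B.measure,
      ∀ᵐ x ∂B.measure, smoothStep α β (p.fst x) - smoothStep α β 0 = B.offset g := by
  obtain ⟨K, hK0, hK⟩ := B.exists_poincare hd
  obtain ⟨C, hC⟩ := exists_deriv_smoothStep_le hαβ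
  set ψ : ℝ → ℝ := fun s ↦ smoothStep α β s - smoothStep α β 0 with hψ
  have hψs : ContDiff ℝ ∞ ψ := contDiff_smoothStep.sub contDiff_const
  have hψ0 : ψ 0 = 0 := sub_self _
  have hψd : ∀ s, deriv ψ s = deriv (smoothStep α β) s := fun s ↦ deriv_sub_const _
  have hψl : LipschitzWith C ψ := lipschitzWith_of_nnnorm_deriv_le
    (hψs.differentiable (by simp)) fun s ↦ by rw [hψd]; exact hC s
  have hψc : Continuous (deriv ψ) := hψs.continuous_deriv (by simp)
  have hψb : ∀ s, |deriv ψ s| ≤ C := fun s ↦ by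
    rw [hψd]
    exact_mod_cast hC s
  obtain ⟨q, hq, hqp⟩ := mem_closure_iff_seq_limit.1 hp
  have hq1 : Tendsto (fun n ↦ (q n).fst) atTop (𝓝 p.fst) :=
    (B.fstL.continuous.tendsto p).comp hqp
  have hq2 : Tendsto (fun n ↦ (q n).snd) atTop (𝓝 p.snd) :=
    (B.sndL.continuous.tendsto p).comp hqp
  -- Pointwise convergence along a subsequence is needed to evaluate `deriv ψ` in the limit, where
  -- it vanishes because of the gap.
  obtain ⟨ns, hns, hae⟩ := (tendstoInMeasure_of_tendsto_Lp hq1).exists_seq_tendsto_ae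
  set g := hψl.compLp hψ0 p.fst with hg
  have hint : ∀ n, Integrable (fun x ↦ deriv ψ ((q n).fst x) ^ 2 * ‖p.snd x‖ ^ 2) B.measure := by
    intro n
    refine Integrable.bdd_mul (c := C ^ 2) ((Lp.memLp p.snd).integrable_norm_pow (by simp))
      ((hψc.comp_aestronglyMeasurable (Lp.aestronglyMeasurable _)).pow 2)
      (Eventually.of_forall fun x ↦ ?_)
    rw [norm_pow]
    gcongr
    exact hψb _
  -- Poincaré for the composed test function. Its gradient `ψ'(φ) ∇φ` is compared with `ψ'(φ) ∇p`:
  -- the first error vanishes by `L²` convergence of gradients, the remainder by dominated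
  -- convergence.
  have hpair : ∀ n, ‖hψl.compLp hψ0 (q n).fst -
      Lp.const 2 B.measure (B.offset (hψl.compLp hψ0 (q n).fst))‖ ^ 2 ≤
      K ^ 2 * (2 * C ^ 2 * ‖(q n).snd - p.snd‖ ^ 2 +
        2 * ∫ x, deriv ψ ((q n).fst x) ^ 2 * ‖p.snd x‖ ^ 2 ∂B.measure) := by
    intro n
    obtain ⟨φ, hφ, h1, h2⟩ := hq n
    obtain ⟨r, hr, hr1, hr2⟩ := (hφ.comp hψs hψ0).exists_pair
    have e1 : hψl.compLp hψ0 (q n).fst = r.fst := by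
      refine Lp.ext ?_
      filter_upwards [hψl.coeFn_compLp hψ0 (q n).fst, h1, hr1] with x k1 k2 k3
      rw [k1, k3, Function.comp_apply, Function.comp_apply, k2]
    have e2 := hK r (subset_closure hr)
    rw [e1]
    refine (pow_le_pow_left₀ (norm_nonneg _) e2 2).trans ?_
    rw [mul_pow]
    gcongr
    rw [norm_sq_eq_integral, norm_sq_eq_integral ((q n).snd - p.snd), ← integral_const_mul,
      ← integral_const_mul, ← integral_add ?_ ((hint n).const_mul 2)]
    · refine integral_mono_ae ((Lp.memLp _).integrable_norm_pow (by simp)) ?_ ?_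
      · exact (((Lp.memLp _).integrable_norm_pow (by simp)).const_mul _).add
          ((hint n).const_mul 2)
      filter_upwards [hr2, h1, h2, Lp.coeFn_sub (q n).snd p.snd] with x k1 k2 k3 k4
      rw [k1, gradient_comp (hψs.differentiable (by simp) _)
        (hφ.contDiff.differentiable (by simp) _), k4, Pi.sub_apply, ← k2, ← k3]
      set s := deriv ψ ((q n).fst x)
      have hs : s ^ 2 ≤ C ^ 2 := sq_le_sq' (abs_le.1 (hψb _)).1 (abs_le.1 (hψb _)).2
      set a := (q n).snd x
      set c := p.snd x
      have h5 : ‖a‖ ≤ ‖a - c‖ + ‖c‖ := by simpa using norm_add_le (a - c) c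
      have h6 : ‖a‖ ^ 2 ≤ 2 * ‖a - c‖ ^ 2 + 2 * ‖c‖ ^ 2 := by
        nlinarith [norm_nonneg a, sq_nonneg (‖a - c‖ - ‖c‖)]
      rw [norm_smul, mul_pow, Real.norm_eq_abs, sq_abs]
      nlinarith [mul_le_mul_of_nonneg_left h6 (sq_nonneg s),
        mul_le_mul_of_nonneg_right hs (sq_nonneg ‖a - c‖)]
    · exact ((Lp.memLp _).integrable_norm_pow (by simp)).const_mul _
  have hlimI : Tendsto (fun n ↦ ∫ x, deriv ψ ((q (ns n)).fst x) ^ 2 * ‖p.snd x‖ ^ 2 ∂B.measure)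
      atTop (𝓝 0) := by
    have := tendsto_integral_of_dominated_convergence (μ := B.measure) (f := fun _ ↦ (0 : ℝ))
      (F := fun n x ↦ deriv ψ ((q (ns n)).fst x) ^ 2 * ‖p.snd x‖ ^ 2)
      (fun x ↦ C ^ 2 * ‖p.snd x‖ ^ 2) (fun n ↦ (hint (ns n)).1)
      (((Lp.memLp p.snd).integrable_norm_pow (by simp)).const_mul _)
      (fun n ↦ Eventually.of_forall fun x ↦ by
        rw [norm_mul, norm_pow, norm_pow, norm_norm]
        gcongr
        exact hψb _)
      (by
        filter_upwards [hae, hgap] with x h1 h2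
        have h3 := ((hψc.tendsto _).comp h1).pow 2
        rw [hψd, deriv_smoothStep_eq_zero hαβ h2] at h3
        simpa using h3.mul_const (‖p.snd x‖ ^ 2))
    simpa using this
  have hlim1 : Tendsto (fun n ↦ ‖(q (ns n)).snd - p.snd‖ ^ 2) atTop (𝓝 0) := by
    have := ((hq2.comp hns.tendsto_atTop).sub_const p.snd).norm.pow 2
    simpa using this
  have hG : Continuous fun h : Lp ℝ 2 B.measure ↦
      ‖hψl.compLp hψ0 h - Lp.const 2 B.measure (B.offset (hψl.compLp hψ0 h))‖ ^ 2 := by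
    have h1 := hψl.continuous_compLp hψ0 (p := 2) (μ := B.measure)
    exact (h1.sub ((Lp.constL 2 B.measure ℝ).continuous.comp
      (B.offset.continuous.comp h1))).norm.pow 2
  have hle := le_of_tendsto_of_tendsto' ((hG.tendsto _).comp (hq1.comp hns.tendsto_atTop))
    (((hlim1.const_mul (2 * (C : ℝ) ^ 2)).add (hlimI.const_mul 2)).const_mul (K ^ 2))
    fun n ↦ hpair (ns n)
  have hzero : g - Lp.const 2 B.measure (B.offset g) = 0 := by
    have : ‖g - Lp.const 2 B.measure (B.offset g)‖ ^ 2 ≤ 0 := by simpa using hle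
    simpa using le_antisymm this (sq_nonneg _)
  refine ⟨g, ?_⟩
  have h1 := hψl.coeFn_compLp hψ0 p.fst
  have h2 := Lp.coeFn_const (p := 2) (μ := B.measure) (B.offset g)
  rw [← sub_eq_zero.1 hzero] at h2
  filter_upwards [h1, h2] with x h1 h2
  rw [h1] at h2
  exact h2

/-- A function in the energy space that omits an interval stays on one side of it. -/
theorem ae_le_or_ae_ge (hd : 1 ≤ d) {α β : ℝ} (hαβ : α < β) (v : B.energySpace)
    (hgap : ∀ᵐ x ∂B.measure, B.toL2 v x ∉ Ioo α β) :
    (∀ᵐ x ∂B.measure, B.toL2 v x ≤ α) ∨ ∀ᵐ x ∂B.measure, β ≤ B.toL2 v x := by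
  obtain ⟨g, hg⟩ := exists_smoothStep_ae_eq hd hαβ (B.energySpace_le v.2) hgap
  by_cases h : ∀ᵐ x ∂B.measure, β ≤ B.toL2 v x
  · exact Or.inr h
  · left
    obtain ⟨y, hy, hy1, hy2⟩ := ((not_eventually.1 h).and_eventually (hg.and hgap)).exists
    have hy3 : B.toL2 v y ≤ α := by
      by_contra h'
      exact hy2 ⟨not_le.1 h', not_le.1 hy⟩
    change smoothStep α β (B.toL2 v y) - _ = _ at hy1
    rw [(smoothStep_eq_zero_iff hαβ).2 hy3] at hy1
    filter_upwards [hg] with x hx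
    rw [← hy1, sub_left_inj, smoothStep_eq_zero_iff hαβ] at hx
    exact hx

/-- For Dirichlet conditions a step across `(0, β)` would be identically one although its offset is
zero; in the periodic case the mean would be positive. -/
theorem not_ae_ge (hd : 1 ≤ d) {β : ℝ} (hβ : 0 < β) (v : B.energySpace) :
    ¬ ∀ᵐ x ∂B.measure, β ≤ B.toL2 v x := by
  intro h
  have hne : NeZero B.measure := ⟨B.measure_ne_zero⟩
  cases B with
  | dirichlet Ω ho hb hn =>
    obtain ⟨g, hg⟩ := exists_smoothStep_ae_eq hd hβ (energySpace_le _ v.2)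
      (h.mono fun x hx hx' ↦ not_lt.2 hx hx'.2)
    obtain ⟨x, h1, h2⟩ := (hg.and h).exists
    change smoothStep 0 β ((dirichlet Ω ho hb hn).toL2 v x) - _ = _ at h1
    rw [(smoothStep_eq_one_iff hβ).2 h2, (smoothStep_eq_zero_iff hβ).2 le_rfl] at h1
    have h3 : (dirichlet Ω ho hb hn).offset g = 0 := rfl
    rw [h3] at h1
    norm_num at h1
  | periodic b =>
    have hm := (periodic b).measureReal_pos
    have h1 := offset_toL2 v
    rw [offset_periodic] at h1
    rw [measure, measureReal_restrict_apply_univ] at hm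
    have h0 : (volume.real (ZSpan.fundamentalDomain b))⁻¹ ≠ 0 := (inv_pos.2 hm).ne'
    have h2 := (mul_eq_zero.1 h1).resolve_left h0
    have h3 := integral_mono_ae (integrable_const β)
      ((Lp.memLp ((periodic b).toL2 v)).integrable (by norm_num)) h
    rw [h2, integral_const, smul_eq_mul] at h3
    exact absurd h3 (not_le.2 (mul_pos (periodic b).measureReal_pos hβ))

theorem not_ae_le (hd : 1 ≤ d) {α : ℝ} (hα : α < 0) (v : B.energySpace) :
    ¬ ∀ᵐ x ∂B.measure, B.toL2 v x ≤ α := by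
  intro h
  refine not_ae_ge hd (neg_pos.2 hα) (-v) ?_
  filter_upwards [h, Lp.coeFn_neg (B.toL2 v)] with x h1 h2
  have h3 : B.toL2 (-v) = -B.toL2 v := rfl
  rw [h3, h2, Pi.neg_apply]
  linarith

end BoundaryCondition

/-! ### The union of the essential ranges is convex. -/

section EssRange

variable {d : ℕ} {B : BoundaryCondition d} {T : ℝ}

theorem notMem_essRange {u : ℝ → B.energySpace} {s : ℝ} : s ∉ essRange B T u ↔
    ∃ U ∈ 𝓝 s, ∀ᵐ t ∂volume.restrict (Ioo 0 T), ∀ᵐ x ∂B.measure, B.toL2 (u t) x ∉ U := by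
  simp [essRange, Filter.not_frequently]

/-- Almost every value lies in the essential range. -/
theorem ae_mem_essRange (u : ℝ → B.energySpace) :
    ∀ᵐ t ∂volume.restrict (Ioo 0 T), ∀ᵐ x ∂B.measure, B.toL2 (u t) x ∈ essRange B T u := by
  have h : ∀ s ∈ (essRange B T u)ᶜ, ∃ U ∈ 𝓝[(essRange B T u)ᶜ] s,
      ∀ᵐ t ∂volume.restrict (Ioo 0 T), ∀ᵐ x ∂B.measure, B.toL2 (u t) x ∉ U := fun s hs ↦ by
    obtain ⟨U, hU, h⟩ := notMem_essRange.1 hs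
    exact ⟨U, mem_nhdsWithin_of_mem_nhds hU, h⟩
  choose! U hU hUae using h
  -- By the Lindelöf property countably many exceptional neighbourhoods cover the complement, so
  -- their null sets can be united.
  obtain ⟨S, hS, hSc, hcover⟩ := TopologicalSpace.countable_cover_nhdsWithin hU
  have h1 : ∀ᵐ t ∂volume.restrict (Ioo 0 T), ∀ s ∈ S, ∀ᵐ x ∂B.measure, B.toL2 (u t) x ∉ U s :=
    (ae_ball_iff hSc).2 fun s hs ↦ hUae s (hS hs)
  filter_upwards [h1] with t ht
  filter_upwards [(ae_ball_iff hSc).2 ht] with x hx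
  by_contra hcon
  obtain ⟨s, hs, hxs⟩ := mem_iUnion₂.1 (hcover hcon)
  exact hx s hs hxs

theorem Icc_subset_essRange (hd : 1 ≤ d) (hT : 0 < T) (u : ℝ → B.energySpace) {s : ℝ}
    (hs : s ∈ essRange B T u) : uIcc 0 s ⊆ essRange B T u := by
  have hne : NeZero (volume.restrict (Ioo 0 T)) :=
    ⟨by simpa [Measure.restrict_eq_zero] using hT⟩
  intro r hr
  by_contra hcon
  obtain ⟨U, hU, hUae⟩ := notMem_essRange.1 hcon
  obtain ⟨ε, hε, hball⟩ := Metric.mem_nhds_iff.1 hU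
  rw [Real.ball_eq_Ioo] at hball
  have hgap : ∀ {a b}, r - ε ≤ a → b ≤ r + ε → ∀ᵐ t ∂volume.restrict (Ioo 0 T),
      ∀ᵐ x ∂B.measure, B.toL2 (u t) x ∉ Ioo a b := fun ha hb ↦
    hUae.mono fun t ht ↦ ht.mono fun x hx hx' ↦ hx (hball (Ioo_subset_Ioo ha hb hx'))
  rcases lt_trichotomy r 0 with h0 | h0 | h0
  · have hsr : s ≤ r := by
      rcases le_total 0 s with h | h
      · rw [uIcc_of_le h] at hr
        linarith [hr.1]
      · rw [uIcc_of_ge h] at hr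
        exact hr.1
    -- The gap starts at `r` itself: staying below it means staying below a negative number, which
    -- is impossible, and staying above it keeps all values away from `s ≤ r`.
    have hlt : r < min (r + ε) 0 := lt_min (by linarith) h0
    refine notMem_essRange.2 ⟨Iio (min (r + ε) 0), Iio_mem_nhds (hsr.trans_lt hlt), ?_⟩ hs
    filter_upwards [hgap (by linarith : r - ε ≤ r) (min_le_left (r + ε) 0)] with t ht
    rcases B.ae_le_or_ae_ge hd hlt (u t) ht with h | h
    · exact absurd h (B.not_ae_le hd h0 (u t))
    · exact h.mono fun x hx ↦ not_lt.2 hx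
  · obtain ⟨t, ht⟩ := (hgap (by linarith : r - ε ≤ r - ε) le_rfl).exists
    rcases B.ae_le_or_ae_ge hd (by linarith) (u t) ht with h | h
    · exact B.not_ae_le hd (by linarith) (u t) h
    · exact B.not_ae_ge hd (by linarith) (u t) h
  · have hsr : r ≤ s := by
      rcases le_total 0 s with h | h
      · rw [uIcc_of_le h] at hr
        exact hr.2
      · rw [uIcc_of_ge h] at hr
        linarith [hr.2]
    have hlt : max (r - ε) 0 < r := max_lt (by linarith) h0
    refine notMem_essRange.2 ⟨Ioi (max (r - ε) 0), Ioi_mem_nhds (hlt.trans_le hsr), ?_⟩ hs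
    filter_upwards [hgap (le_max_left (r - ε) 0) (by linarith : r ≤ r + ε)] with t ht
    rcases B.ae_le_or_ae_ge hd hlt (u t) ht with h | h
    · exact h.mono fun x hx ↦ not_lt.2 hx
    · exact absurd h (B.not_ae_ge hd h0 (u t))

/-- Both ranges are star-shaped about `0`, and a segment from `a` to `b` lies in the union of the
segments from `0` to `a` and to `b`. -/
theorem convex_essRange_union (hd : 1 ≤ d) (hT : 0 < T) (u w : ℝ → B.energySpace) :
    Convex ℝ (essRange B T u ∪ essRange B T w) := by
  rw [convex_iff_ordConnected, ordConnected_iff_uIcc_subset]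
  have h : ∀ s ∈ essRange B T u ∪ essRange B T w,
      uIcc 0 s ⊆ essRange B T u ∪ essRange B T w := by
    rintro s (hs | hs)
    · exact (Icc_subset_essRange hd hT u hs).trans subset_union_left
    · exact (Icc_subset_essRange hd hT w hs).trans subset_union_right
  intro a ha b hb x hx
  have h1 : x ∈ uIcc 0 a ∨ x ∈ uIcc 0 b := by
    rcases uIcc_subset_uIcc_union_uIcc (b := 0) hx with h | h
    · exact Or.inl (by rwa [uIcc_comm])
    · exact Or.inr h
  rcases h1 with h1 | h1
  · exact h a ha h1
  · exact h b hb h1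

end EssRange

/-! ### Grönwall's inequality. -/

section Gronwall

/-- Grönwall's inequality in integral form. -/
theorem le_exp_mul_of_le_integral {T K : ℝ} (hK : 0 ≤ K) {y r : ℝ → ℝ}
    (hy : ContinuousOn y (Icc 0 T)) (hy0 : ∀ t, 0 ≤ y t) (hr : IntervalIntegrable r volume 0 T)
    (hr0 : ∀ t, 0 ≤ r t)
    (h : ∀ t ∈ Icc 0 T, y t ≤ y 0 + ∫ s in (0 : ℝ)..t, (K * y s + r s)) {t : ℝ}
    (ht : t ∈ Icc 0 T) : y t ≤ Real.exp (K * t) * (y 0 + ∫ s in (0 : ℝ)..t, r s) := by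
  have hT : 0 ≤ T := ht.1.trans ht.2
  -- Extending `y` continuously to the line makes its primitive differentiable everywhere.
  set z : ℝ → ℝ := IccExtend hT ((Icc 0 T).domRestrict y) with hz
  have hzc : Continuous z := hy.domRestrict.Icc_extend'
  have hzy : ∀ s ∈ Icc 0 T, z s = y s := fun s hs ↦ by
    rw [hz, IccExtend_of_mem hT _ hs]
    rfl
  have hz0 : ∀ s, 0 ≤ z s := fun s ↦ hy0 _
  have hri : ∀ s ∈ Icc 0 T, IntervalIntegrable r volume 0 s := fun s hs ↦
    hr.mono_set (uIcc_subset_uIcc_left (by rwa [uIcc_of_le hT]))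
  -- The forcing is frozen at its integral up to the final time `t`; as `r` is nonnegative, this
  -- majorizes all earlier times.
  set ρ := y 0 + ∫ s in (0 : ℝ)..t, r s with hρ
  have hρ0 : 0 ≤ ρ :=
    add_nonneg (hy0 0) (intervalIntegral.integral_nonneg ht.1 fun s _ ↦ hr0 s)
  have hle : ∀ s ∈ Icc 0 t, z s ≤ ρ + K * ∫ a in (0 : ℝ)..s, z a := by
    intro s hs
    have hsT : s ∈ Icc 0 T := ⟨hs.1, hs.2.trans ht.2⟩
    have h1 : ∫ a in (0 : ℝ)..s, (K * y a + r a) =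
        K * (∫ a in (0 : ℝ)..s, z a) + ∫ a in (0 : ℝ)..s, r a := by
      rw [← intervalIntegral.integral_const_mul, ← intervalIntegral.integral_add
        ((hzc.intervalIntegrable 0 s).const_mul K) (hri s hsT)]
      refine intervalIntegral.integral_congr fun a ha ↦ ?_
      rw [uIcc_of_le hs.1] at ha
      rw [hzy a ⟨ha.1, ha.2.trans hsT.2⟩]
    have h2 : ∫ a in (0 : ℝ)..s, r a ≤ ∫ a in (0 : ℝ)..t, r a :=
      intervalIntegral.integral_mono_interval le_rfl hs.1 hs.2
        (Eventually.of_forall fun a ↦ hr0 a) (hri t ht)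
    have h3 := h s hsT
    rw [h1] at h3
    rw [hzy s hsT, hρ]
    linarith
  set w : ℝ → ℝ := fun s ↦ ρ + K * ∫ a in (0 : ℝ)..s, z a with hw
  have hwd : ∀ s, HasDerivAt w (K * z s) s := fun s ↦
    ((intervalIntegral.integral_hasDerivAt_right (hzc.intervalIntegrable 0 s)
      (hzc.stronglyMeasurableAtFilter _ _) hzc.continuousAt).const_mul K).const_add ρ
  have hw0 : ∀ s ∈ Icc 0 t, 0 ≤ w s := fun s hs ↦ (hz0 s).trans (hle s hs)
  have key := norm_le_gronwallBound_of_norm_deriv_right_le (f := w) (f' := fun s ↦ K * z s)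
    (δ := ρ) (K := K) (ε := 0) (a := 0) (b := t)
    (fun s _ ↦ (hwd s).continuousAt.continuousWithinAt) (fun s _ ↦ (hwd s).hasDerivWithinAt)
    (by simp [hw, abs_of_nonneg hρ0])
    (fun s hs ↦ by
      have hs' := Ico_subset_Icc_self hs
      rw [add_zero, norm_mul, Real.norm_of_nonneg hK, Real.norm_of_nonneg (hz0 s),
        Real.norm_of_nonneg (hw0 s hs')]
      exact mul_le_mul_of_nonneg_left (hle s hs') hK) t ⟨ht.1, le_rfl⟩
  rw [gronwallBound_ε0, sub_zero, Real.norm_of_nonneg (hw0 t ⟨ht.1, le_rfl⟩)] at key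
  rw [← hzy t ht, mul_comm]
  exact (hle t ⟨ht.1, le_rfl⟩).trans key

end Gronwall

/-! ### The flux as an operator on `L²`. -/

section Superposition

/-- The superposition operator of a function that is Lipschitz on `I`, extended to a continuous
operator of linear growth. -/
theorem exists_superposition {α E : Type*} [MeasurableSpace α] {μ : Measure α} [IsFiniteMeasure μ]
    [NormedAddCommGroup E] [NormedSpace ℝ E] [FiniteDimensional ℝ E] {f : ℝ → E} {I : Set ℝ}
    {L : NNReal} (hf : LipschitzOnWith L f I) :
    ∃ F : Lp ℝ 2 μ → Lp E 2 μ, Continuous F ∧ (∃ c k : ℝ, ∀ g, ‖F g‖ ≤ c * ‖g‖ + k) ∧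
      (∀ g, (∀ᵐ x ∂μ, g x ∈ I) → F g =ᵐ[μ] fun x ↦ f (g x)) ∧
      ∀ g h, (∀ᵐ x ∂μ, g x ∈ I) → (∀ᵐ x ∂μ, h x ∈ I) → ‖F g - F h‖ ≤ L * ‖g - h‖ := by
  -- The extension may enlarge the Lipschitz constant. It serves only continuity and growth; the
  -- sharp `L` is recovered for functions with values in `I`.
  obtain ⟨k, hk, hkf⟩ := hf.extend_finite_dimension
  set k₀ : ℝ → E := fun s ↦ k s - k 0
  have hk₀ : LipschitzWith (lipschitzExtensionConstant E * L) k₀ :=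
    LipschitzWith.of_dist_le_mul fun x y ↦ by
      rw [dist_sub_right]
      exact hk.dist_le_mul x y
  have h0 : k₀ 0 = 0 := sub_self _
  set F : Lp ℝ 2 μ → Lp E 2 μ := fun g ↦ hk₀.compLp h0 g + Lp.const 2 μ (k 0) with hF
  have hFae : ∀ g, (∀ᵐ x ∂μ, g x ∈ I) → F g =ᵐ[μ] fun x ↦ f (g x) := by
    intro g hg
    filter_upwards [hg, Lp.coeFn_add (hk₀.compLp h0 g) (Lp.const 2 μ (k 0)),
      hk₀.coeFn_compLp h0 g, Lp.coeFn_const (p := 2) (μ := μ) (k 0)] with x h1 h2 h3 h4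
    rw [hF, h2, Pi.add_apply, h3, h4, hkf h1]
    simp [k₀]
  refine ⟨F, (hk₀.continuous_compLp h0).add continuous_const, ⟨_, ‖Lp.const 2 μ (k 0)‖,
    fun g ↦ (norm_add_le _ _).trans (by gcongr; exact hk₀.norm_compLp_le h0 g)⟩, hFae, ?_⟩
  intro g h hg hh
  refine Lp.norm_le_mul_norm_of_ae_le_mul ?_
  filter_upwards [hFae g hg, hFae h hh, hg, hh, Lp.coeFn_sub (F g) (F h),
    Lp.coeFn_sub g h] with x h1 h2 h3 h4 h5 h6
  rw [h5, h6, Pi.sub_apply, Pi.sub_apply, h1, h2, ← dist_eq_norm, ← dist_eq_norm]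
  exact hf.dist_le_mul _ h3 _ h4

theorem MemL2Time.of_growth {X Y : Type*} [NormedAddCommGroup X] [NormedAddCommGroup Y] {T : ℝ}
    {g : ℝ → X} (hg : MemL2Time T g) {F : X → Y} (hF : Continuous F) {c k : ℝ}
    (h : ∀ x, ‖F x‖ ≤ c * ‖x‖ + k) : MemL2Time T fun t ↦ F (g t) := by
  have h1 : MemLp (fun t ↦ c * ‖g t‖ + k) 2 (volume.restrict (Ioo 0 T)) :=
    ((MemLp.norm hg).const_mul c).add (memLp_const k)
  exact h1.mono' (hF.comp_aestronglyMeasurable hg.1) (Eventually.of_forall fun t ↦ h _)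

end Superposition

/-! ### From the distributional equation to a weak derivative in the dual. -/

section WeakForm

theorem IsTimeTest.integral_mul_inner {T : ℝ} {η : ℝ → ℝ} (hη : IsTimeTest T η) {X : Type*}
    [NormedAddCommGroup X] [InnerProductSpace ℝ X] [CompleteSpace X] {g : ℝ → X}
    (hg : MemL2Time T g) (x : X) :
    ∫ t in Ioo 0 T, η t * inner ℝ (g t) x = inner ℝ (∫ t in Ioo 0 T, η t • g t) x := by
  rw [real_inner_comm, ← integral_inner (hη.integrableOn_smul hg.integrableOn)]
  simp only [inner_smul_right]
  simp only [real_inner_comm x]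

theorem HasWeakDeriv.sub {V H : Type*} [NormedAddCommGroup V] [InnerProductSpace ℝ V]
    [CompleteSpace V] [NormedAddCommGroup H] [InnerProductSpace ℝ H] [CompleteSpace H] {T : ℝ}
    {ι : V →L[ℝ] H} {e₁ e₂ γ₁ γ₂ : ℝ → V} (he₁ : MemL2Time T e₁) (hγ₁ : MemL2Time T γ₁)
    (h₁ : HasWeakDeriv T ι e₁ γ₁) (he₂ : MemL2Time T e₂) (hγ₂ : MemL2Time T γ₂)
    (h₂ : HasWeakDeriv T ι e₂ γ₂) :
    HasWeakDeriv T ι (fun t ↦ e₁ t - e₂ t) fun t ↦ γ₁ t - γ₂ t := by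
  intro η v hη
  have k₁ := h₁ η v hη
  have k₂ := h₂ η v hη
  rw [hη.deriv.integral_mul_inner (he₁.clm ι), hη.integral_mul_inner hγ₁] at k₁
  rw [hη.deriv.integral_mul_inner (he₂.clm ι), hη.integral_mul_inner hγ₂] at k₂
  have he : MemL2Time T fun t ↦ ι (e₁ t - e₂ t) :=
    MemL2Time.clm (g := fun t ↦ e₁ t - e₂ t) (MemLp.sub he₁ he₂) ι
  have hγ : MemL2Time T fun t ↦ γ₁ t - γ₂ t := MemLp.sub hγ₁ hγ₂
  change ∫ t in Ioo 0 T, deriv η t * inner ℝ (ι (e₁ t - e₂ t)) (ι v) =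
    -∫ t in Ioo 0 T, η t * inner ℝ (γ₁ t - γ₂ t) v
  rw [hη.deriv.integral_mul_inner he, hη.integral_mul_inner hγ]
  simp only [map_sub, smul_sub]
  rw [integral_sub (hη.deriv.integrableOn_smul (he₁.clm ι).integrableOn)
    (hη.deriv.integrableOn_smul (he₂.clm ι).integrableOn),
    integral_sub (hη.integrableOn_smul hγ₁.integrableOn)
    (hη.integrableOn_smul hγ₂.integrableOn), inner_sub_left, inner_sub_left, k₁, k₂]
  ring

variable {d : ℕ} (B : BoundaryCondition d)

/-- The closure of the smooth pairs, i.e. the energy space without the condition on the mean. -/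
abbrev pairSpace : Submodule ℝ (L2Pair B.measure) := B.smoothPairs.topologicalClosure

/-- The `L²` function underlying an element of `pairSpace`. -/
def pairFst : pairSpace B →L[ℝ] Lp ℝ 2 B.measure := B.fstL ∘L (pairSpace B).subtypeL

/-- The gradient of an element of `pairSpace`. -/
def pairSnd : pairSpace B →L[ℝ] Lp (Space d) 2 B.measure := B.sndL ∘L (pairSpace B).subtypeL

/-- The inclusion of the energy space in `pairSpace`. -/
def energyIncl : B.energySpace →L[ℝ] pairSpace B :=
  B.energySpace.subtypeL.codRestrict (pairSpace B) fun v ↦ B.energySpace_le v.2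

@[simp] theorem pairFst_energyIncl (v : B.energySpace) : pairFst B (energyIncl B v) = B.toL2 v :=
  rfl

@[simp] theorem pairSnd_energyIncl (v : B.energySpace) : pairSnd B (energyIncl B v) = B.grad v :=
  rfl

theorem norm_pairFst_le (v : pairSpace B) : ‖pairFst B v‖ ≤ ‖v‖ := by
  have h : ‖(v : L2Pair B.measure).fst‖ ^ 2 ≤ ‖(v : L2Pair B.measure)‖ ^ 2 := by
    rw [WithLp.prod_norm_sq_eq_of_L2]
    exact le_add_of_nonneg_right (sq_nonneg _)
  exact (pow_le_pow_iff_left₀ (norm_nonneg _) (norm_nonneg _) two_ne_zero).1 h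

variable {B}

/-- The functional `v ↦ (R, v) + (Φ, ∇v) - ν (∇u, ∇v)` on `pairSpace`, with `Φ` the flux. -/
def weakDerivOf (ν : ℝ) (R : Lp ℝ 2 B.measure) (Φ : Lp (Space d) 2 B.measure)
    (u : B.energySpace) : pairSpace B :=
  ContinuousLinearMap.adjoint (pairFst B) R +
    ContinuousLinearMap.adjoint (pairSnd B) (Φ - ν • B.grad u)

theorem inner_weakDerivOf (ν : ℝ) (R : Lp ℝ 2 B.measure) (Φ : Lp (Space d) 2 B.measure)
    (u : B.energySpace) (v : pairSpace B) : inner ℝ (weakDerivOf ν R Φ u) v =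
      inner ℝ R (pairFst B v) + inner ℝ (Φ - ν • B.grad u) (pairSnd B v) := by
  rw [weakDerivOf, inner_add_left, ContinuousLinearMap.adjoint_inner_left,
    ContinuousLinearMap.adjoint_inner_left]

variable {T ν : ℝ} {u : ℝ → B.energySpace} {R : ℝ → Lp ℝ 2 B.measure}
  {Φ : ℝ → Lp (Space d) 2 B.measure}

theorem MemL2Time.grad (hu : MemL2Time T u) : MemL2Time T fun t ↦ B.grad (u t) :=
  (hu.clm (energyIncl B)).clm (pairSnd B)

theorem MemL2Time.toL2 (hu : MemL2Time T u) : MemL2Time T fun t ↦ B.toL2 (u t) :=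
  (hu.clm (energyIncl B)).clm (pairFst B)

theorem MemL2Time.flux (hu : MemL2Time T u) (hΦ : MemL2Time T Φ) :
    MemL2Time T fun t ↦ Φ t - ν • B.grad (u t) :=
  MemLp.sub hΦ (MemLp.const_smul hu.grad ν)

theorem MemL2Time.weakDerivOf (hu : MemL2Time T u) (hR : MemL2Time T R) (hΦ : MemL2Time T Φ) :
    MemL2Time T fun t ↦ weakDerivOf ν (R t) (Φ t) (u t) :=
  MemLp.add (hR.clm (ContinuousLinearMap.adjoint (pairFst B)))
    ((hu.flux hΦ).clm (ContinuousLinearMap.adjoint (pairSnd B)))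

/-- The distributional equation, tested against the whole energy space. -/
theorem HasResidual.hasWeakDeriv {f : ℝ → Space d} (hu : MemL2Time T u) (hR : MemL2Time T R)
    (hΦ : MemL2Time T Φ)
    (hf : ∀ᵐ t ∂volume.restrict (Ioo 0 T), Φ t =ᵐ[B.measure] fun x ↦ f (B.toL2 (u t) x))
    (h : HasResidual B ν T f u R) :
    HasWeakDeriv T (pairFst B) (fun t ↦ energyIncl B (u t))
      fun t ↦ weakDerivOf ν (R t) (Φ t) (u t) := by
  intro η v hη
  set X₁ := ∫ t in Ioo 0 T, deriv η t • B.toL2 (u t) with hX₁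
  set X₂ := ∫ t in Ioo 0 T, η t • R t with hX₂
  set Y := ∫ t in Ioo 0 T, η t • (Φ t - ν • B.grad (u t)) with hY
  -- Integrating in time first turns the equation into the vanishing of one continuous functional of
  -- the pair, a closed condition known on smooth pairs. Periodic test functions of nonzero mean are
  -- covered because `pairSpace` imposes no mean.
  have key : ∀ p ∈ pairSpace B, inner ℝ X₁ p.fst + (inner ℝ X₂ p.fst + inner ℝ Y p.snd) = 0 := by
    intro p hp
    have hcl : IsClosed {p : L2Pair B.measure |
        inner ℝ X₁ p.fst + (inner ℝ X₂ p.fst + inner ℝ Y p.snd) = 0} := by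
      refine isClosed_eq ?_ continuous_const
      have c1 := B.fstL.continuous
      have c2 := B.sndL.continuous
      exact (continuous_const.inner c1).add
        ((continuous_const.inner c1).add (continuous_const.inner c2))
    refine closure_minimal (fun q hq ↦ ?_) hcl hp
    obtain ⟨φ, hφ, h1, h2⟩ := hq
    have hs : ∀ g : Lp ℝ 2 B.measure, ∫ x, g x * φ x ∂B.measure = inner ℝ g q.fst := fun g ↦ by
      rw [L2.inner_def]
      refine integral_congr_ae (h1.mono fun x hx ↦ ?_)
      simp only [hx, RCLike.inner_apply, conj_trivial]
      ring
    have hv : ∀ G : Lp (Space d) 2 B.measure,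
        ∫ x, inner ℝ (G x) (gradient φ x) ∂B.measure = inner ℝ G q.snd := fun G ↦ by
      rw [L2.inner_def]
      exact integral_congr_ae (h2.mono fun x hx ↦ by simp only [hx])
    have hfl : ∫ t in Ioo 0 T, η t *
        ∫ x, inner ℝ (f (B.toL2 (u t) x)) (gradient φ x) ∂B.measure =
        ∫ t in Ioo 0 T, η t * inner ℝ (Φ t) q.snd := by
      refine integral_congr_ae (hf.mono fun t ht ↦ ?_)
      simp only
      rw [← hv]
      congr 1
      exact integral_congr_ae (ht.mono fun x hx ↦ by simp only [hx])
    have e := h η φ hη hφ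
    rw [hfl] at e
    simp only [hs, hv] at e
    have eY : inner ℝ Y q.snd = (∫ t in Ioo 0 T, η t * inner ℝ (Φ t) q.snd) -
        ν * ∫ t in Ioo 0 T, η t * inner ℝ (B.grad (u t)) q.snd := by
      have e1 := integral_sub (hη.integrableOn_smul hΦ.integrableOn)
        (Integrable.smul ν (hη.integrableOn_smul hu.grad.integrableOn))
      simp only [Pi.smul_apply, integral_smul] at e1
      rw [hη.integral_mul_inner hΦ, hη.integral_mul_inner hu.grad, hY, ← real_inner_smul_left,
        ← inner_sub_left, ← e1]
      simp only [smul_sub, smul_comm ν]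
    rw [hη.integral_mul_inner hR, hη.deriv.integral_mul_inner hu.toL2] at e
    rw [mem_ofPred_eq, eY]
    linarith
  simp only [inner_weakDerivOf, mul_add]
  have i1 : IntegrableOn (fun t ↦ η t * inner ℝ (R t) (pairFst B v)) (Ioo 0 T) :=
    hη.integrableOn_smul (hR.integrableOn.inner_const _)
  have i2 : IntegrableOn (fun t ↦ η t * inner ℝ (Φ t - ν • B.grad (u t)) (pairSnd B v))
      (Ioo 0 T) := hη.integrableOn_smul ((hu.flux hΦ).integrableOn.inner_const _)
  rw [integral_add i1 i2, hη.integral_mul_inner hR, hη.integral_mul_inner (hu.flux hΦ)]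
  simp only [pairFst_energyIncl]
  rw [hη.deriv.integral_mul_inner hu.toL2]
  have := key v v.2
  exact eq_neg_of_add_eq_zero_left this

end WeakForm

/-! ### The energy estimate. -/

/-- Young's inequality, in the form needed for the energy estimate. -/
theorem two_mul_sub_le_of_pos {ν : ℝ} (hν : 0 < ν) (a b x : ℝ) :
    2 * (a * x + b * x - ν * x ^ 2) ≤ b ^ 2 / ν + a ^ 2 / ν := by
  have h : b ^ 2 / ν + a ^ 2 / ν - 2 * (a * x + b * x - ν * x ^ 2) =
      ((a - ν * x) ^ 2 + (b - ν * x) ^ 2) / ν := by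
    field_simp
    ring
  have h2 : 0 ≤ ((a - ν * x) ^ 2 + (b - ν * x) ^ 2) / ν := by positivity
  linarith

/-- Taking the root halves the exponent, and `√(b² + c²) ≤ b + c`. -/
theorem le_exp_mul_of_sq_le {ν a b K C I t : ℝ} (hν : 0 < ν) (ha : 0 ≤ a) (hb : 0 ≤ b)
    (hC : 0 ≤ C) (hI : 0 ≤ I)
    (h : a ^ 2 ≤ Real.exp (K ^ 2 / ν * t) * (b ^ 2 + C ^ 2 / ν * I)) :
    a ≤ Real.exp (K ^ 2 / (2 * ν) * t) * (b + C / √ν * √I) := by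
  refine (pow_le_pow_iff_left₀ ha (by positivity) two_ne_zero).1 (h.trans ?_)
  rw [mul_pow, ← Real.exp_nat_mul]
  have e1 : ((2 : ℕ) : ℝ) * (K ^ 2 / (2 * ν) * t) = K ^ 2 / ν * t := by
    push_cast
    field_simp
  have e2 : (C / √ν * √I) ^ 2 = C ^ 2 / ν * I := by
    rw [mul_pow, div_pow, Real.sq_sqrt hν.le, Real.sq_sqrt hI]
  rw [e1]
  gcongr
  rw [← e2]
  have : 0 ≤ C / √ν * √I := by positivity
  nlinarith

variable {d : ℕ} {B : BoundaryCondition d}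

/-- The mean value inequality needs the convexity of the union of the ranges. -/
theorem lipschitzOnWith_essRange (hd : 1 ≤ d) {T : ℝ} (hT : 0 < T) {f : ℝ → Space d}
    (hf : ContDiff ℝ 1 f) {u w : ℝ → B.energySpace} (h : BddAbove (speeds B T f u w)) :
    LipschitzOnWith (sSup (speeds B T f u w)).toNNReal f (essRange B T u ∪ essRange B T w) := by
  refine (convex_essRange_union hd hT u w).lipschitzOnWith_of_nnnorm_deriv_le
    (fun s _ ↦ hf.differentiable (by simp) s) fun s hs ↦ ?_
  rw [← NNReal.coe_le_coe, coe_nnnorm]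
  exact (le_csSup h ⟨s, hs, rfl⟩).trans (Real.le_coe_toNNReal _)

/-- The pairing is `-(R, e) + (Ψ - Φ, ∇e) - ν‖∇e‖²` with `e = w - u`. Poincaré and Cauchy–Schwarz
make the first two terms linear in `‖∇e‖`, and Young's inequality consumes the dissipation. -/
theorem energy_density_le {ν C L : ℝ} (hν : 0 < ν)
    (hC : ∀ v : B.energySpace, ‖B.toL2 v‖ ≤ C * ‖B.grad v‖) (R : Lp ℝ 2 B.measure)
    {Φ Ψ : Lp (Space d) 2 B.measure} {u w : B.energySpace}
    (hΦ : ‖Ψ - Φ‖ ≤ L * ‖B.toL2 w - B.toL2 u‖) :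
    2 * inner ℝ (weakDerivOf ν 0 Ψ w - weakDerivOf ν R Φ u) (energyIncl B w - energyIncl B u) ≤
      L ^ 2 / ν * ‖B.toL2 (w - u)‖ ^ 2 + C ^ 2 / ν * ‖R‖ ^ 2 := by
  have e : energyIncl B w - energyIncl B u = energyIncl B (w - u) := (map_sub _ _ _).symm
  have eg : B.grad (w - u) = B.grad w - B.grad u := rfl
  have et : B.toL2 (w - u) = B.toL2 w - B.toL2 u := rfl
  rw [← et] at hΦ
  set x := ‖B.grad (w - u)‖ with hx
  have h1 : inner ℝ (weakDerivOf ν 0 Ψ w - weakDerivOf ν R Φ u) (energyIncl B (w - u)) =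
      -inner ℝ R (B.toL2 (w - u)) + inner ℝ (Ψ - Φ) (B.grad (w - u)) - ν * x ^ 2 := by
    rw [inner_sub_left, inner_weakDerivOf, inner_weakDerivOf, pairFst_energyIncl,
      pairSnd_energyIncl, hx, ← real_inner_self_eq_norm_sq]
    have e2 : ν * inner ℝ (B.grad (w - u)) (B.grad (w - u)) =
        ν * inner ℝ (B.grad w) (B.grad (w - u)) - ν * inner ℝ (B.grad u) (B.grad (w - u)) := by
      rw [← mul_sub, ← inner_sub_left, ← eg]
    rw [e2]
    simp only [inner_sub_left, inner_zero_left, real_inner_smul_left]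
    ring
  have h2 : -inner ℝ R (B.toL2 (w - u)) ≤ C * ‖R‖ * x := by
    have h3 := (abs_le.1 (abs_real_inner_le_norm R (B.toL2 (w - u)))).1
    have h4 := mul_le_mul_of_nonneg_left (hC (w - u)) (norm_nonneg R)
    nlinarith
  have h5 : inner ℝ (Ψ - Φ) (B.grad (w - u)) ≤ L * ‖B.toL2 (w - u)‖ * x :=
    (real_inner_le_norm _ _).trans (by gcongr)
  have h6 := two_mul_sub_le_of_pos hν (C * ‖R‖) (L * ‖B.toL2 (w - u)‖) x
  rw [e, h1]
  rw [mul_pow, mul_pow, mul_div_right_comm, mul_div_right_comm (C ^ 2)] at h6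
  linarith

end ViscousLaw

end

/-! ### The error estimate. -/

theorem mainTheorem2 {d : ℕ} (hd : 1 ≤ d) (B : ViscousLaw.BoundaryCondition d) :
    ∃ C_P : ℝ, 0 < C_P ∧ B.IsPoincareConstant C_P ∧
      ∀ (ν T : ℝ) (f : ℝ → ViscousLaw.Space d) (u uν : ℝ → B.energySpace)
        (R : ℝ → Lp ℝ 2 B.measure),
        0 < ν → 0 < T → ContDiff ℝ 1 f →
        -- the exact solution
        ViscousLaw.MemL2Time T uν → ViscousLaw.IsWeakSolution B ν T f uν →
        -- the approximation and its residual
        ViscousLaw.MemL2Time T u → ViscousLaw.HasTimeDerivInDual B T u →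
        ViscousLaw.HasResidual B ν T f u R → ViscousLaw.MemL2Time T R →
        -- finiteness of the supremum that defines `L_f`
        BddAbove (ViscousLaw.speeds B T f u uν) →
        ∃ U Uν : ℝ → Lp ℝ 2 B.measure,
          ViscousLaw.IsContinuousRep B T u U ∧ ViscousLaw.IsContinuousRep B T uν Uν ∧
          ∀ t ∈ Icc 0 T,
            ‖Uν t - U t‖ ≤
              Real.exp ((sSup (ViscousLaw.speeds B T f u uν)) ^ 2 / (2 * ν) * t) *
                (‖Uν 0 - U 0‖ + C_P / Real.sqrt ν * Real.sqrt (∫ s in (0 : ℝ)..t, ‖R s‖ ^ 2)) := by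
  obtain ⟨C, hC0, hC⟩ := B.exists_isPoincareConstant hd
  refine ⟨C, hC0, hC, ?_⟩
  -- the time derivative of `u` is in the dual because the residual and the flux are
  intro ν T f u w R hν hT hf hw hweq hu _ hueq hR hbdd
  set L := sSup (ViscousLaw.speeds B T f u w) with hL
  have hL0 : 0 ≤ L := Real.sSup_nonneg fun x hx ↦ by
    obtain ⟨s, -, rfl⟩ := hx
    exact norm_nonneg _
  obtain ⟨F, hFc, ⟨c, k, hFg⟩, hFae, hFL⟩ := ViscousLaw.exists_superposition (μ := B.measure)
    (ViscousLaw.lipschitzOnWith_essRange hd hT hf hbdd)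
  rw [Real.coe_toNNReal _ hL0] at hFL
  have hIu := (ViscousLaw.ae_mem_essRange (T := T) u).mono fun t ht ↦
    ht.mono fun x hx ↦ (Or.inl hx : _ ∈ ViscousLaw.essRange B T u ∪ ViscousLaw.essRange B T w)
  have hIw := (ViscousLaw.ae_mem_essRange (T := T) w).mono fun t ht ↦
    ht.mono fun x hx ↦ (Or.inr hx : _ ∈ ViscousLaw.essRange B T u ∪ ViscousLaw.essRange B T w)
  have hΦu : ViscousLaw.MemL2Time T fun t ↦ F (B.toL2 (u t)) := hu.toL2.of_growth hFc hFg
  have hΦw : ViscousLaw.MemL2Time T fun t ↦ F (B.toL2 (w t)) := hw.toL2.of_growth hFc hFg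
  have h0 : ViscousLaw.MemL2Time T fun _ ↦ (0 : Lp ℝ 2 B.measure) := memLp_const 0
  have hdu := hueq.hasWeakDeriv hu hR hΦu (hIu.mono fun t ht ↦ hFae _ ht)
  have hdw := ViscousLaw.HasResidual.hasWeakDeriv hw h0 hΦw
    (hIw.mono fun t ht ↦ hFae _ ht) hweq
  have hγu := hu.weakDerivOf (ν := ν) hR hΦu
  have hγw := hw.weakDerivOf (ν := ν) h0 hΦw
  have hu' := hu.clm (ViscousLaw.energyIncl B)
  have hw' := hw.clm (ViscousLaw.energyIncl B)
  obtain ⟨U, hUc, hUae, -⟩ :=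
    hdu.exists_continuousOn hT (ViscousLaw.norm_pairFst_le B) hu' hγu
  have hγ : ViscousLaw.MemL2Time T fun s ↦
      ViscousLaw.weakDerivOf ν 0 (F (B.toL2 (w s))) (w s) -
        ViscousLaw.weakDerivOf ν (R s) (F (B.toL2 (u s))) (u s) := MemLp.sub hγw hγu
  have he : ViscousLaw.MemL2Time T fun s ↦
      ViscousLaw.energyIncl B (w s) - ViscousLaw.energyIncl B (u s) := MemLp.sub hw' hu'
  obtain ⟨E, hEc, hEae, hE⟩ := (hdw.sub hw' hγw hu' hγu hdu).exists_continuousOn hT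
    (ViscousLaw.norm_pairFst_le B) he hγ
  -- The representative of `uν` is taken as `U + E`, so the error equals `E` at every time and the
  -- energy identity applies without comparing representatives.
  refine ⟨U, fun t ↦ U t + E t, ⟨hUc, hUae⟩, ⟨hUc.add hEc, ?_⟩, fun t ht ↦ ?_⟩
  · filter_upwards [hUae, hEae] with t h1 h2
    rw [h1, h2, map_sub]
    simp
  simp only [add_sub_cancel_left]
  have hRi : IntervalIntegrable (fun s ↦ ‖R s‖ ^ 2) volume 0 T :=
    (intervalIntegrable_iff_integrableOn_Ioo_of_le hT.le).2 (MemLp.integrable_norm_pow hR (by simp))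
  -- Grönwall is applied to `‖E‖²` with rate `L² / ν`.
  refine ViscousLaw.le_exp_mul_of_sq_le hν (norm_nonneg _) (norm_nonneg _) hC0.le
    (intervalIntegral.integral_nonneg ht.1 fun s _ ↦ sq_nonneg _) ?_
  rw [← intervalIntegral.integral_const_mul]
  refine ViscousLaw.le_exp_mul_of_le_integral (T := T) (y := fun t ↦ ‖E t‖ ^ 2)
    (by positivity) (hEc.norm.pow 2) (fun t ↦ sq_nonneg _) (hRi.const_mul _)
    (fun t ↦ by positivity) (fun t ht ↦ ?_) ht
  have hsub : Ioc 0 t ⊆ Ioc 0 T := Ioc_subset_Ioc_right ht.2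
  have hyi : IntervalIntegrable (fun s ↦ ‖E s‖ ^ 2) volume 0 T :=
    ContinuousOn.intervalIntegrable (by rw [uIcc_of_le hT.le]; exact hEc.norm.pow 2)
  have hi₁ : IntervalIntegrable (fun s ↦ inner ℝ
      (ViscousLaw.weakDerivOf ν 0 (F (B.toL2 (w s))) (w s) -
        ViscousLaw.weakDerivOf ν (R s) (F (B.toL2 (u s))) (u s))
      (ViscousLaw.energyIncl B (w s) - ViscousLaw.energyIncl B (u s))) volume 0 T := by
    refine (intervalIntegrable_iff_integrableOn_Ioo_of_le hT.le).2 ?_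
    exact (hγ.integrableOn_norm_mul_norm he).mono' (hγ.1.inner he.1)
      (Eventually.of_forall fun s ↦ norm_inner_le_norm _ _)
  have hmono : uIcc 0 t ⊆ uIcc 0 T := uIcc_subset_uIcc_left (by rwa [uIcc_of_le hT.le])
  rw [hE t ht]
  gcongr
  rw [← intervalIntegral.integral_const_mul]
  refine intervalIntegral.integral_mono_ae_restrict ht.1 ((hi₁.const_mul 2).mono_set hmono)
    (((hyi.const_mul _).add (hRi.const_mul _)).mono_set hmono) ?_
  rw [Measure.restrict_congr_set Ioc_ae_eq_Icc.symm]
  refine ae_restrict_of_ae_restrict_of_subset hsub ?_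
  rw [ViscousLaw.restrict_Ioc_eq_restrict_Ioo]
  filter_upwards [hEae, hIu, hIw] with s h1 h2 h3
  rw [h1, ← map_sub]
  have key := ViscousLaw.energy_density_le hν hC.1 (R s) (hFL _ _ h3 h2)
  rw [← map_sub] at key
  exact key
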